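/- Let $d\ge 0$, let $\Lambda\subset\mathbb Z^d$ range over the hyper-cubes $\prod_i\{c_i,\dots,c_i+L-1\}$, and write $s_{[A]}=\prod_{x\in A}s_x$ for $s\in\{\pm1\}^\Lambda$, $A\subseteq\Lambda$, and $s^A$ for $s$ with the spins in $A$ reversed. Let $\mu>0$, $\eta\in\mathbb R$, $\alpha\ge0$ and $$\phi_x(s_\Lambda)=\sum_{A\subseteq\Lambda}J_0(x;A)s_{[A]},\quad J_0(x;\{x\})=1,\qquad U^0(s_\Lambda)=-\alpha\sum_{A\subseteq\Lambda}J^0_A s_{[A]},\quad J^0_A\ge0,\quad J^0_A=0\text{ for odd }|A|,$$ where $J_0$ and $J^0$ are translation invariant and short-range: $\sum_{A}|J_0(0;A)|<\infty$ and $\|J^0\|:=\sum_{A\ni0}J^0_A<\infty$ (sums over finite $A\subset\mathbb Z^d$). Put $U(s;q)=2\mu\eta\sum_{x\in\Lambda}q_x\phi_x(s)+U^0(s)$. For each $\Lambda$ and $A\subseteq\Lambda$ let $J_A(q_\Lambda)\le0$ be a bounded measurable function. On $(\otimes\mathbb C^2)^{|\Lambda|}\otimes L^2(\mathbb R^\Lambda)$,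 with Pauli matrices $S^1_x,S^3_x$, let $$H_\Lambda=\sum_{x\in\Lambda}\big[-\partial_x^2+\mu^2(q_x+\eta\phi_x(S^3_\Lambda))^2-\mu\big]+\sum_{A\subseteq\Lambda}J_AS^1_{[A]}+V_\Lambda,\qquad V_\Lambda=-\sum_{A\subseteq\Lambda}J_A\,e^{-\frac12[U(S^{3A}_\Lambda;q)-U(S^3_\Lambda;q)]},$$ where $S^{3A}_\Lambda$ is $S^3_\Lambda$ with the sign of $S^3_x$ reversed for $x\in A$, with domain $\big((\otimes\mathbb C^2)^{|\Lambda|}\otimes\mathbb S(\mathbb R^\Lambda)\big)\cap D(V_\Lambda)$, $\mathbb S$ being the Schwartz space. Let $\Psi_\Lambda$ be the vector whose component at $q_\Lambda$ along the joint eigenvector of the $S^3_x$ with eigenvalues $s_x$ is $e^{-\frac12U(s;q)}\prod_{x\in\Lambda}(\mu/\pi)^{1/4}e^{-\mu q_x^2/2}$, and let $\langle T\rangle_\Lambda=(\Psi_\Lambda,T\Psi_\Lambda)/(\Psi_\Lambda,\Psi_\Lambda)$. Then $\Psi_\Lambda$ is a ground state of $H_\Lambda$, with eigenvalue $0$. Assume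 moreover that $J_0\ge0$ and $J_0(x;A)=0$ for even $|A|$. (I) Let $d\ge2$. There are constants $\beta_0>1$ and $a>0$, depending only on $d$, such that if $J_0(x;\{y\})\ge\bar J$ and $J^0_{\{x,y\}}\ge\bar J$ for all nearest neighbours $x,y$ and $\beta=(\eta^2\mu+\alpha)\bar J\ge\beta_0$, then for all $\Lambda$ and all $x,y\in\Lambda$ $$\langle S^3_xS^3_y\rangle_\Lambda\ge a,\qquad \langle\hat q_x\hat q_y\rangle_\Lambda\ge\eta^2a ,$$ where $\hat q_x$ is multiplication by $q_x$. That is, there is ferromagnetic long-range order in $S^3$ and, if $\eta\ne0$, in the oscillator variables. (II) Let $d\ge 0$ be arbitrary and suppose that there are positive constants $C,B_1,B_2$ with $|\phi_x(s_\Lambda)|\le C$ and $W^{(j)}_A(s_\Lambda)=\sum_{x'\in\Lambda}|\phi_{x'}^j(s^A_\Lambda)-\phi_{x'}^j(s_\Lambda)|\le B_j$ ($j=1,2$) for all $\Lambda$, $x\in\Lambda$, $s_\Lambda$ and all $A\subseteq\Lambda$ with $|A|=2$. Then for all $\Lambda$ and all $x,y\in\Lambda$ $$\langle S^1_xS^1_y\rangle_\Lambda\ge\exp\Big\{-\tfrac{\eta^2\mu}{4}(B_2+2CB_1)-\tfrac{\alpha}{2}B_0\Big\}>0,\qquad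 B_0=4\|J^0\| ,$$ i.e. there is ferromagnetic long-range order in $S^1$. -/

import Mathlib

open scoped BigOperators SchwartzMap

noncomputable section

/-- Sites of the hyper-cubic lattice `ℤ^d`. -/
abbrev Site (d : ℕ) : Type := Fin d → ℤ

/-- `Λ` is a hyper-cube: `∏ i, {c i, c i + 1, …, c i + L - 1}` for a corner `c` and a side `L`. -/
def IsHypercube {d : ℕ} (Λ : Finset (Site d)) : Prop :=
  ∃ (c : Site d) (L : ℕ), Λ = Fintype.piFinset fun i => Finset.Ico (c i) (c i + (L : ℤ))

/-- Nearest neighbours of `ℤ^d`. -/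
def NearestNeighbors {d : ℕ} (x y : Site d) : Prop := ∑ i, |x i - y i| = 1

/-- Spin configurations `s_Λ`, with `s_x = ±1`. -/
abbrev SpinConfig {d : ℕ} (Λ : Finset (Site d)) : Type := Λ → ℤˣ

/-- Oscillator configurations `q_Λ ∈ ℝ^Λ`. -/
abbrev OscConfig {d : ℕ} (Λ : Finset (Site d)) : Type := Λ → ℝ

/-- The monomial `s_[A] = ∏_{x ∈ A} s_x` as a real number. -/
def spinProd {d : ℕ} {Λ : Finset (Site d)} (A : Finset Λ) (s : SpinConfig Λ) : ℝ :=
  ∏ x ∈ A, ((s x : ℤ) : ℝ)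

/-- The configuration `s^A`: the spins in `A` are reversed, the others are unchanged. -/
def flipSpins {d : ℕ} {Λ : Finset (Site d)} (A : Finset Λ) (s : SpinConfig Λ) : SpinConfig Λ :=
  fun x => if x ∈ A then -s x else s x

/-- A subset of `Λ` viewed as a finite subset of the lattice. -/
def toLattice {d : ℕ} {Λ : Finset (Site d)} (A : Finset Λ) : Finset (Site d) :=
  A.map (Function.Embedding.subtype _)

/-- The data of the spin-oscillator systems, with the standing assumptions on them:
`μ`, `η`, the interaction `J₀(x;A)` that defines `φ_x`, the even ferromagnetic interaction
`α`, `J⁰_A` that defines `U⁰`, and, for every finite `Λ` and `A ⊆ Λ`, the bounded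
non-positive measurable function `J_A(q_Λ)`. -/
structure SpinOscModel (d : ℕ) where
  /-- oscillator frequency -/
  μ : ℝ
  μ_pos : 0 < μ
  /-- spin-oscillator coupling -/
  η : ℝ
  /-- the interaction `J₀(x;A)` -/
  J₀ : Site d → Finset (Site d) → ℝ
  J₀_self : ∀ x, J₀ x {x} = 1
  J₀_translation : ∀ (a x : Site d) (A : Finset (Site d)),
    J₀ (x + a) (A.image fun y => y + a) = J₀ x A
  J₀_shortRange : Summable fun A : Finset (Site d) => |J₀ 0 A|
  /-- strength of `U⁰` -/
  α : ℝ
  α_nonneg : 0 ≤ α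
  /-- the interaction `J⁰_A` -/
  JU : Finset (Site d) → ℝ
  JU_nonneg : ∀ A, 0 ≤ JU A
  JU_odd : ∀ A, Odd A.card → JU A = 0
  JU_translation : ∀ (a : Site d) (A : Finset (Site d)), JU (A.image fun y => y + a) = JU A
  JU_shortRange : Summable fun A : {A : Finset (Site d) // (0 : Site d) ∈ A} => |JU A|
  /-- the functions `J_A(q_Λ)` multiplying `S¹_[A]` -/
  JS : (Λ : Finset (Site d)) → Finset Λ → OscConfig Λ → ℝ
  JS_measurable : ∀ Λ A, Measurable (JS Λ A)
  JS_bounded : ∀ Λ A, ∃ K : ℝ, ∀ q, |JS Λ A q| ≤ K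
  JS_nonpos : ∀ Λ A q, JS Λ A q ≤ 0

/-- Wave functions `F(q_Λ; s_Λ)`: the coefficients of an element of
`(⊗ ℂ²)^{|Λ|} ⊗ L²(ℝ^Λ)` in the basis of joint eigenvectors of the `S³_x`. -/
abbrev WaveFn {d : ℕ} (Λ : Finset (Site d)) : Type := OscConfig Λ → SpinConfig Λ → ℂ

/-- The scalar product `∑_s ∫ conj F₁(q;s) F₂(q;s) dq`. -/
def waveInner {d : ℕ} {Λ : Finset (Site d)} (F₁ F₂ : WaveFn Λ) : ℂ :=
  ∑ s : SpinConfig Λ, ∫ q : OscConfig Λ, (starRingEnd ℂ) (F₁ q s) * F₂ q s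

/-- `S¹_[A]`, the product over `x ∈ A` of the first Pauli matrices at `x`; the first Pauli matrix
interchanges the two basis vectors. -/
def opS1Prod {d : ℕ} {Λ : Finset (Site d)} (A : Finset Λ) (F : WaveFn Λ) : WaveFn Λ :=
  fun q s => F q (flipSpins A s)

/-- The first Pauli matrix at `x`. -/
def opS1 {d : ℕ} {Λ : Finset (Site d)} (x : Λ) (F : WaveFn Λ) : WaveFn Λ := opS1Prod {x} F

/-- The third Pauli matrix at `x`. -/
def opS3 {d : ℕ} {Λ : Finset (Site d)} (x : Λ) (F : WaveFn Λ) : WaveFn Λ :=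
  fun q s => ((s x : ℤ) : ℂ) * F q s

/-- Multiplication by the oscillator variable `q_x`. -/
def opQ {d : ℕ} {Λ : Finset (Site d)} (x : Λ) (F : WaveFn Λ) : WaveFn Λ :=
  fun q s => (q x : ℂ) * F q s

/-- The second partial derivative in `q_x`. -/
def opD2 {d : ℕ} {Λ : Finset (Site d)} (x : Λ) (F : WaveFn Λ) : WaveFn Λ :=
  fun q s => iteratedDeriv 2 (fun t : ℝ => F (Function.update q x t) s) (q x)

/-- `Ψ` is a ground state of the operator `H` with domain `D`: a non-zero eigenvector in the
domain whose eigenvalue is a lower bound of the quadratic form of `H`. -/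
def IsGroundState {d : ℕ} {Λ : Finset (Site d)} (H : WaveFn Λ → WaveFn Λ) (D : Set (WaveFn Λ))
    (Ψ : WaveFn Λ) : Prop :=
  Ψ ∈ D ∧ Ψ ≠ 0 ∧ ∃ E : ℝ, (∀ q s, H Ψ q s = (E : ℂ) * Ψ q s) ∧
    ∀ F ∈ D, E * (waveInner F F).re ≤ (waveInner F (H F)).re

namespace SpinOscModel

variable {d : ℕ} (M : SpinOscModel d) (Λ : Finset (Site d))

/-- `φ_x(s_Λ) = ∑_{A ⊆ Λ} J₀(x;A) s_[A]`. -/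
def φ (x : Λ) (s : SpinConfig Λ) : ℝ :=
  ∑ A : Finset Λ, M.J₀ x (toLattice A) * spinProd A s

/-- `U⁰(s_Λ) = -α ∑_{A ⊆ Λ} J⁰_A s_[A]`. -/
def U0 (s : SpinConfig Λ) : ℝ :=
  -M.α * ∑ A : Finset Λ, M.JU (toLattice A) * spinProd A s

/-- `∑_{A ∋ 0} J⁰_A`, the sum being over the finite subsets of the lattice containing `0`. -/
def normJU : ℝ := ∑' A : {A : Finset (Site d) // (0 : Site d) ∈ A}, M.JU A

/-- The quasi-potential energy `U(s;q) = 2 μ η ∑_x q_x φ_x(s) + U⁰(s)`. -/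
def U (s : SpinConfig Λ) (q : OscConfig Λ) : ℝ :=
  2 * M.μ * M.η * ∑ x : Λ, q x * M.φ Λ x s + M.U0 Λ s

/-- `V_Λ = -∑_{A ⊆ Λ} J_A(q) exp(-(1/2) W_A)`, `W_A = U(s^A;q) - U(s;q)`. -/
def V (q : OscConfig Λ) (s : SpinConfig Λ) : ℝ :=
  -∑ A : Finset Λ, M.JS Λ A q * Real.exp (-(1 / 2) * (M.U Λ (flipSpins A s) q - M.U Λ s q))

/-- The Hamiltonian
`H_Λ = ∑_x [-∂_x² + μ² (q_x + η φ_x(S³))² - μ] + ∑_{A ⊆ Λ} J_A S¹_[A] + V_Λ`. -/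
def hamiltonian (F : WaveFn Λ) : WaveFn Λ := fun q s =>
  ∑ x : Λ, (-opD2 x F q s
      + ((M.μ ^ 2 * (q x + M.η * M.φ Λ x s) ^ 2 - M.μ : ℝ) : ℂ) * F q s)
    + ∑ A : Finset Λ, (M.JS Λ A q : ℂ) * opS1Prod A F q s
    + (M.V Λ q s : ℂ) * F q s

/-- The domain `((⊗ ℂ²)^{|Λ|} ⊗ 𝓢(ℝ^Λ)) ∩ D(V_Λ)` of the Hamiltonian. -/
def domain : Set (WaveFn Λ) :=
  {F | ∀ s : SpinConfig Λ, (∃ f : 𝓢(OscConfig Λ, ℂ), ∀ q, F q s = f q) ∧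
    MeasureTheory.MemLp (fun q => (M.V Λ q s : ℂ) * F q s) 2 MeasureTheory.volume}

/-- The one-oscillator ground state `ψ₀(q) = (μ/π)^{1/4} exp(-μ q²/2)`. -/
def ψ₀ (q : ℝ) : ℝ := (M.μ / Real.pi) ^ (1 / 4 : ℝ) * Real.exp (-(M.μ / 2) * q ^ 2)

/-- The Gibbsian vector `Ψ_Λ(q;s) = exp(-U(s;q)/2) ∏_x ψ₀(q_x)`. -/
def Ψ : WaveFn Λ := fun q s =>
  ((Real.exp (-(1 / 2) * M.U Λ s q) * ∏ x : Λ, M.ψ₀ (q x) : ℝ) : ℂ)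

/-- The average `⟨T⟩_Λ = (Ψ_Λ, T Ψ_Λ) / (Ψ_Λ, Ψ_Λ)`. -/
def average (T : WaveFn Λ → WaveFn Λ) : ℂ :=
  waveInner (M.Ψ Λ) (T (M.Ψ Λ)) / waveInner (M.Ψ Λ) (M.Ψ Λ)

/-- `W^{(j)}_A(s) = ∑_{x' ∈ Λ} |φ_{x'}(s^A)^j - φ_{x'}(s)^j|`. -/
def W (j : ℕ) (A : Finset Λ) (s : SpinConfig Λ) : ℝ :=
  ∑ x' : Λ, |M.φ Λ x' (flipSpins A s) ^ j - M.φ Λ x' s ^ j|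

end SpinOscModel

end

/-!
**Reduction to a spin model.** At fixed spins `Ψ_Λ` is a shifted Gaussian in the oscillator
variables, so these can be integrated out. The overlap of the components at `s` and `s'` is
`exp (-(U⁰(s) + U⁰(s')) / 2 + μ η² ∑_x ((φ_x(s) + φ_x(s')) / 2)²)`, and in `|Ψ_Λ|²` the spins have
the ferromagnetic interaction `μ η² ∑_x φ_x² - U⁰` (`SpinOscModel.spinInteraction`).

**Ground state.** Each oscillator term is `a† a` with `a = ∂_x + μ (q_x + η φ_x)`, by integration
by parts for Schwartz functions (`oscillator_nonneg`). The spin-flip terms together with `V_Λ` form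
a non-negative quadratic form once `s` is paired with `s^A` (`flip_form_nonneg`). Both parts vanish
on `Ψ_Λ`.

**Order in `S³` and in the oscillators.** By Griffiths' second inequality
(`Ferromagnetic.correlation_mono`) all of the spin interaction except the nearest-neighbour
couplings in a coordinate plane can be dropped, which leaves an Ising model on a square grid with
free boundary and coupling `(η² μ + α) J̄`. There `peierls_bound` shows that two sites of a row
rarely disagree. Its contours are the `ℤ/2`-cocycles of the grid: the set of unsatisfied edges of a
configuration that separates two sites contains a connected cocycle that separates them
(`exists_connected_contour`), and flipping one side of it removes exactly its edges. Two arbitrary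
sites of the hyper-cube are joined by `d` moves along the axes, hence the dependence of `β₀` on `d`.
For the oscillators, `⟨q_x q_y⟩ ≥ η² ⟨φ_x φ_y⟩`, and `φ_x φ_y` contains `s_x s_y` among its
non-negative terms.

**Order in `S¹`.** `⟨S¹_x S¹_y⟩` is a sum of overlaps of the components at `s` and `s^{x,y}`, and
each is bounded below by the stated exponential times the weight of `s`
(`SpinOscModel.le_overlap_flip_pair`).
-/

noncomputable section

/-! ### Contours of a spin configuration on a square grid -/

/-- Edges of the grid `ℕ × ℕ`: `(i, j, false)` joins `(i, j)` to `(i + 1, j)`, and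
`(i, j, true)` joins `(i, j)` to `(i, j + 1)`. -/
abbrev GridEdge : Type := ℕ × ℕ × Bool

/-- The second endpoint of a grid edge; the first one is `(e.1, e.2.1)`. -/
def gridTgt (e : GridEdge) : ℕ × ℕ := bif e.2.2 then (e.1, e.2.1 + 1) else (e.1 + 1, e.2.1)

/-- The edges of the grid `{0, …, L - 1}²`. -/
def gridEdges (L : ℕ) : Finset GridEdge :=
  (Finset.range L ×ˢ Finset.range L ×ˢ Finset.univ).filter
    fun e => (gridTgt e).1 < L ∧ (gridTgt e).2 < L

/-- The multiplicative gradient of a spin field: `-1` on the edges that join opposite spins. -/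
def grad (t : ℕ → ℕ → ℤˣ) (e : GridEdge) : ℤˣ := t e.1 e.2.1 * t (gridTgt e).1 (gridTgt e).2

/-- The four edges of the plaquette with lower left corner `p`. -/
def plaq (p : ℕ × ℕ) : Finset GridEdge :=
  {(p.1, p.2, false), (p.1, p.2 + 1, false), (p.1, p.2, true), (p.1 + 1, p.2, true)}

/-- The edges that share a plaquette with `e`. On the border of the quadrant, where the
subtraction truncates, both plaquettes below are the same one. -/
def edgeNbrs (e : GridEdge) : Finset GridEdge :=
  plaq (e.1, e.2.1) ∪ bif e.2.2 then plaq (e.1 - 1, e.2.1) else plaq (e.1, e.2.1 - 1)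

/-- The multiplicative indicator of a set of edges: `-1` on `S` and `1` elsewhere. -/
def edgeSign (S : Finset GridEdge) (e : GridEdge) : ℤˣ := if e ∈ S then -1 else 1

/-- Every plaquette of the grid of side `L` has an even number of edges in `S`. -/
def IsCocycle (L : ℕ) (S : Finset GridEdge) : Prop :=
  ∀ i j, i + 1 < L → j + 1 < L →
    edgeSign S (i, j, false) * edgeSign S (i, j + 1, false) *
      (edgeSign S (i, j, true) * edgeSign S (i + 1, j, true)) = 1

/-- The spin field whose gradient is `edgeSign S` when `S` is a cocycle, obtained by
integrating along the bottom row and then up the column. -/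
def potential (S : Finset GridEdge) (i j : ℕ) : ℤˣ :=
  (∏ k ∈ Finset.range i, edgeSign S (k, 0, false)) * ∏ l ∈ Finset.range j, edgeSign S (i, l, true)

/-- The edges of the grid that join opposite spins of `t`. -/
def badEdges (L : ℕ) (t : ℕ → ℕ → ℤˣ) : Finset GridEdge :=
  (gridEdges L).filter fun e => grad t e = -1

/-- `S` is connected through plaquettes. -/
def EdgeConn (S : Finset GridEdge) : Prop :=
  ∀ T ⊆ S, T.Nonempty → (∀ v ∈ T, ∀ u ∈ S, u ∈ edgeNbrs v → u ∈ T) → T = S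

lemma mem_gridEdges {L : ℕ} {e : GridEdge} : e ∈ gridEdges L ↔
    (e.1 < L ∧ e.2.1 < L) ∧ (gridTgt e).1 < L ∧ (gridTgt e).2 < L := by
  simp [gridEdges]

lemma mem_gridEdges_false {L i j : ℕ} : (i, j, false) ∈ gridEdges L ↔ i + 1 < L ∧ j < L := by
  rw [mem_gridEdges]
  simp only [gridTgt, cond_false]
  omega

lemma mem_gridEdges_true {L i j : ℕ} : (i, j, true) ∈ gridEdges L ↔ i < L ∧ j + 1 < L := by
  rw [mem_gridEdges]
  simp only [gridTgt, cond_true]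
  omega

lemma grad_false (t : ℕ → ℕ → ℤˣ) (i j : ℕ) : grad t (i, j, false) = t i j * t (i + 1) j := rfl

lemma grad_true (t : ℕ → ℕ → ℤˣ) (i j : ℕ) : grad t (i, j, true) = t i j * t i (j + 1) := rfl

lemma grad_mul (t u : ℕ → ℕ → ℤˣ) (e : GridEdge) :
    grad (fun i j => t i j * u i j) e = grad t e * grad u e := by
  simp only [grad]; exact mul_mul_mul_comm _ _ _ _

lemma mem_plaq_edgeNbrs {p : ℕ × ℕ} {u v : GridEdge} (hu : u ∈ plaq p) (hv : v ∈ plaq p) :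
    u ∈ edgeNbrs v := by
  obtain ⟨i, j⟩ := p
  have hv' := hv
  simp only [plaq, Finset.mem_insert, Finset.mem_singleton] at hv
  rcases hv with rfl | rfl | rfl | rfl <;>
    simp only [edgeNbrs, Finset.mem_union, cond_true, cond_false, Nat.add_sub_cancel] <;> tauto

lemma exists_plaq_of_mem_edgeNbrs {u v : GridEdge} (h : u ∈ edgeNbrs v) :
    ∃ p, u ∈ plaq p ∧ v ∈ plaq p := by
  obtain ⟨i, j, b⟩ := v
  rcases Finset.mem_union.1 h with h | h
  · exact ⟨_, h, by cases b <;> simp [plaq]⟩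
  · cases b
    · refine ⟨_, h, ?_⟩
      rcases j with _ | j <;> simp [plaq]
    · refine ⟨_, h, ?_⟩
      rcases i with _ | i <;> simp [plaq]

lemma edgeNbrs_symm {u v : GridEdge} (h : u ∈ edgeNbrs v) : v ∈ edgeNbrs u := by
  obtain ⟨p, hu, hv⟩ := exists_plaq_of_mem_edgeNbrs h
  exact mem_plaq_edgeNbrs hv hu

lemma card_edgeNbrs_le (e : GridEdge) : (edgeNbrs e).card ≤ 8 := by
  have hp : ∀ p, (plaq p).card ≤ 4 := fun p => Finset.card_le_four
  refine (Finset.card_union_le _ _).trans ?_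
  have h1 := hp (e.1, e.2.1)
  cases e.2.2
  · have h2 := hp (e.1, e.2.1 - 1)
    simp only [cond_false]; omega
  · have h2 := hp (e.1 - 1, e.2.1)
    simp only [cond_true]; omega

lemma edgeSign_mul_sdiff {S B : Finset GridEdge} (h : S ⊆ B) (e : GridEdge) :
    edgeSign S e * edgeSign (B \ S) e = edgeSign B e := by
  by_cases h1 : e ∈ S
  · simp [edgeSign, h1, h h1]
  · by_cases h2 : e ∈ B <;> simp [edgeSign, h1, h2]

lemma potential_mul_sdiff {S B : Finset GridEdge} (h : S ⊆ B) (i j : ℕ) :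
    potential S i j * potential (B \ S) i j = potential B i j := by
  simp only [potential, ← edgeSign_mul_sdiff h, Finset.prod_mul_distrib]
  exact mul_mul_mul_comm _ _ _ _

lemma grad_potential {L : ℕ} {S : Finset GridEdge} (hS : IsCocycle L S) {e : GridEdge}
    (he : e ∈ gridEdges L) : grad (potential S) e = edgeSign S e := by
  obtain ⟨i, j, b⟩ := e
  cases b
  · rw [mem_gridEdges_false] at he
    obtain ⟨hi, hj⟩ := he
    induction j with
    | zero =>
      simp only [grad_false, potential, Finset.range_zero, Finset.prod_empty, mul_one,
        Finset.prod_range_succ]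
      rw [← mul_assoc, Int.units_mul_self, one_mul]
    | succ j ih =>
      have h1 := ih (by omega)
      have h2 := hS i j hi hj
      rw [grad_false] at h1 ⊢
      have e1 : ∀ i, potential S i (j + 1) = potential S i j * edgeSign S (i, j, true) := by
        intro i
        simp only [potential, Finset.prod_range_succ, mul_assoc]
      rw [e1, e1, mul_mul_mul_comm, h1]
      generalize edgeSign S (i, j, false) = a at *
      generalize edgeSign S (i, j + 1, false) = b at *
      generalize edgeSign S (i, j, true) * edgeSign S (i + 1, j, true) = c at *
      calc a * c = a * c * (b * b) := by rw [Int.units_mul_self, mul_one]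
        _ = a * b * c * b := by ac_rfl
        _ = b := by rw [h2, one_mul]
  · have e1 : potential S i (j + 1) = potential S i j * edgeSign S (i, j, true) := by
      simp only [potential, Finset.prod_range_succ, mul_assoc]
    rw [grad_true, e1, ← mul_assoc, Int.units_mul_self, one_mul]

lemma edgeSign_badEdges {L : ℕ} (t : ℕ → ℕ → ℤˣ) {e : GridEdge} (he : e ∈ gridEdges L) :
    edgeSign (badEdges L t) e = grad t e := by
  rcases Int.units_eq_one_or (grad t e) with h | h <;> simp [edgeSign, badEdges, he, h]

lemma isCocycle_badEdges (L : ℕ) (t : ℕ → ℕ → ℤˣ) : IsCocycle L (badEdges L t) := by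
  intro i j hi hj
  rw [edgeSign_badEdges t (mem_gridEdges_false.2 ⟨hi, by omega⟩),
    edgeSign_badEdges t (mem_gridEdges_false.2 ⟨hi, by omega⟩),
    edgeSign_badEdges t (mem_gridEdges_true.2 ⟨by omega, hj⟩),
    edgeSign_badEdges t (mem_gridEdges_true.2 ⟨by omega, hj⟩)]
  simp only [grad_false, grad_true]
  generalize t i j = a
  generalize t (i + 1) j = b
  generalize t i (j + 1) = c
  generalize t (i + 1) (j + 1) = d
  calc a * b * (c * d) * (a * c * (b * d)) = (a * a) * (b * b) * (c * c) * (d * d) := by ac_rfl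
    _ = 1 := by simp only [Int.units_mul_self, mul_one]

/-- A field with trivial gradient along a segment of a row is constant there. -/
lemma row_eq {t : ℕ → ℕ → ℤˣ} {r a : ℕ} (b : ℕ) (hab : a ≤ b)
    (h : ∀ k, a ≤ k → k < b → grad t (k, r, false) = 1) : t a r = t b r := by
  induction b, hab using Nat.le_induction with
  | base => rfl
  | succ b hab ih =>
    rw [ih fun k h1 h2 => h k h1 (by omega)]
    have := h b hab (by omega)
    rw [grad_false] at this
    exact (mul_eq_one_iff_eq_inv.1 this).trans (Int.units_inv_eq_self _)

lemma col_eq {t : ℕ → ℕ → ℤˣ} {i a : ℕ} (b : ℕ) (hab : a ≤ b)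
    (h : ∀ k, a ≤ k → k < b → grad t (i, k, true) = 1) : t i a = t i b := by
  induction b, hab using Nat.le_induction with
  | base => rfl
  | succ b hab ih =>
    rw [ih fun k h1 h2 => h k h1 (by omega)]
    have := h b hab (by omega)
    rw [grad_true] at this
    exact (mul_eq_one_iff_eq_inv.1 this).trans (Int.units_inv_eq_self _)

/-- A spin field is recovered from its unsatisfied edges, up to a global sign. -/
lemma mul_potential_badEdges {L : ℕ} (t : ℕ → ℕ → ℤˣ) {i j : ℕ} (hi : i < L) (hj : j < L) :
    t i j * potential (badEdges L t) i j = t 0 0 := by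
  set u : ℕ → ℕ → ℤˣ := fun i j => t i j * potential (badEdges L t) i j with hu
  have hg : ∀ e ∈ gridEdges L, grad u e = 1 := by
    intro e he
    rw [hu, grad_mul, grad_potential (isCocycle_badEdges L t) he, edgeSign_badEdges t he,
      Int.units_mul_self]
  have h1 : u i 0 = u i j := col_eq j (Nat.zero_le _) fun k _ hk =>
    hg _ (mem_gridEdges_true.2 ⟨hi, by omega⟩)
  have h2 : u 0 0 = u i 0 := row_eq i (Nat.zero_le _) fun k _ hk =>
    hg _ (mem_gridEdges_false.2 ⟨by omega, by omega⟩)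
  have h3 : u 0 0 = t 0 0 := by simp [hu, potential]
  rw [← h3, h2, h1]

lemma potential_badEdges_ne {L : ℕ} (t : ℕ → ℕ → ℤˣ) {i j i' j' : ℕ} (hi : i < L) (hj : j < L)
    (hi' : i' < L) (hj' : j' < L) (h : t i j ≠ t i' j') :
    potential (badEdges L t) i j ≠ potential (badEdges L t) i' j' := by
  intro he
  have h1 := mul_potential_badEdges t hi hj
  have h2 := mul_potential_badEdges t hi' hj'
  rw [he, ← h2] at h1
  exact h (mul_right_cancel h1)

/-- If `T ⊆ B` is closed under plaquette adjacency in `B`, each plaquette sees all of `B` through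
`T` or nothing of `T`, so the cocycle property passes from `B` to `T`. -/
lemma IsCocycle.of_closed {L : ℕ} {B T : Finset GridEdge} (hB : IsCocycle L B) (hT : T ⊆ B)
    (hc : ∀ v ∈ T, ∀ u ∈ B, u ∈ edgeNbrs v → u ∈ T) : IsCocycle L T := by
  intro i j hi hj
  by_cases h : ∃ v ∈ plaq (i, j), v ∈ T
  · obtain ⟨v, hv, hvT⟩ := h
    have key : ∀ e ∈ plaq (i, j), edgeSign T e = edgeSign B e := by
      intro e he
      have : e ∈ T ↔ e ∈ B := ⟨fun h => hT h, fun h => hc v hvT e h (mem_plaq_edgeNbrs he hv)⟩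
      simp only [edgeSign, this]
    rw [key _ (by simp [plaq]), key _ (by simp [plaq]), key _ (by simp [plaq]),
      key _ (by simp [plaq])]
    exact hB i j hi hj
  · push Not at h
    have key : ∀ e ∈ plaq (i, j), edgeSign T e = 1 := fun e he => by simp [edgeSign, h e he]
    rw [key _ (by simp [plaq]), key _ (by simp [plaq]), key _ (by simp [plaq]),
      key _ (by simp [plaq])]
    simp

/-- A cocycle that separates two sites contains a connected cocycle that separates them: if it is
not connected it splits into two smaller cocycles, and the potentials multiply, so one of the two
still separates the sites. -/
lemma exists_connected_contour {L i j i' j' : ℕ} (B : Finset GridEdge) (hB : IsCocycle L B)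
    (hsep : potential B i j ≠ potential B i' j') :
    ∃ S ⊆ B, IsCocycle L S ∧ EdgeConn S ∧ potential S i j ≠ potential S i' j' := by
  induction hn : B.card using Nat.strong_induction_on generalizing B with
  | _ n ih =>
    by_cases hconn : EdgeConn B
    · exact ⟨B, subset_rfl, hB, hconn, hsep⟩
    · simp only [EdgeConn, not_forall] at hconn
      obtain ⟨T, hTB, hne, hcl, hTne⟩ := hconn
      have hss : T ⊂ B := lt_of_le_of_ne hTB hTne
      have hT : IsCocycle L T := hB.of_closed hTB hcl
      have hT' : IsCocycle L (B \ T) := by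
        refine hB.of_closed Finset.sdiff_subset fun v hv u hu huv => ?_
        rw [Finset.mem_sdiff] at hv ⊢
        exact ⟨hu, fun huT => hv.2 (hcl u huT v hv.1 (edgeNbrs_symm huv))⟩
      by_cases h : potential T i j = potential T i' j'
      · have h2 : potential (B \ T) i j ≠ potential (B \ T) i' j' := by
          intro h2
          apply hsep
          rw [← potential_mul_sdiff hTB, ← potential_mul_sdiff hTB, h, h2]
        have hlt : (B \ T).card < n := by
          rw [← hn]
          exact Finset.card_lt_card (Finset.sdiff_ssubset hTB hne)
        obtain ⟨S, hS, h3⟩ := ih _ hlt _ hT' h2 rfl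
        exact ⟨S, hS.trans Finset.sdiff_subset, h3⟩
      · obtain ⟨S, hS, h3⟩ := ih _ (hn ▸ Finset.card_lt_card hss) _ hT h rfl
        exact ⟨S, hS.trans hTB, h3⟩

/-! ### Counting connected contours -/

/-- The walks with `n` steps that start at `e`, from edge to adjacent edge. -/
def edgeWalks : ℕ → GridEdge → Finset (List GridEdge)
  | 0, e => {[e]}
  | n + 1, e => (edgeNbrs e).biUnion fun u => (edgeWalks n u).image (e :: ·)

lemma card_edgeWalks_le (n : ℕ) (e : GridEdge) : (edgeWalks n e).card ≤ 8 ^ n := by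
  induction n generalizing e with
  | zero => simp [edgeWalks]
  | succ n ih =>
    calc (edgeWalks (n + 1) e).card ≤ (edgeNbrs e).card * 8 ^ n :=
          Finset.card_biUnion_le_card_mul _ _ _ fun u _ => Finset.card_image_le.trans (ih u)
      _ ≤ 8 * 8 ^ n := Nat.mul_le_mul_right _ (card_edgeNbrs_le e)
      _ = 8 ^ (n + 1) := by ring

lemma mem_edgeWalks (l : List GridEdge) (e : GridEdge)
    (h : List.IsChain (fun v u => u ∈ edgeNbrs v) (e :: l)) : e :: l ∈ edgeWalks l.length e := by
  induction l generalizing e with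
  | nil => simp [edgeWalks]
  | cons u l ih =>
    rw [List.isChain_cons_cons] at h
    simp only [edgeWalks, List.length_cons, Finset.mem_biUnion, Finset.mem_image]
    exact ⟨u, h.1, _, ih u h.2, rfl⟩

/-- A connected set of edges is covered by a walk of length `2 (|S| - 1)` from any of its edges:
each new edge is reached by a detour `v, u, v` from an edge `v` already visited. -/
lemma EdgeConn.exists_walk {S : Finset GridEdge} (hS : EdgeConn S) {e : GridEdge} (he : e ∈ S) :
    S ∈ (edgeWalks (2 * (S.card - 1)) e).image List.toFinset := by
  have key : ∀ k, k < S.card → ∃ T ⊆ S, T.card = k + 1 ∧ ∃ l : List GridEdge,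
      List.IsChain (fun v u => u ∈ edgeNbrs v) (e :: l) ∧ (e :: l).toFinset = T ∧
      l.length = 2 * k := by
    intro k
    induction k with
    | zero =>
      intro _
      exact ⟨{e}, by simpa using he, by simp, [], by simp, by simp, by simp⟩
    | succ k ih =>
      intro hk
      obtain ⟨T, hTS, hcard, l, hl, hlT, hlen⟩ := ih (by omega)
      have hne : T ≠ S := by rintro rfl; omega
      have hnc : ¬ ∀ v ∈ T, ∀ u ∈ S, u ∈ edgeNbrs v → u ∈ T := fun h =>
        hne (hS T hTS ⟨e, by rw [← hlT]; simp⟩ h)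
      push Not at hnc
      obtain ⟨v, hv, u, hu, huv, huT⟩ := hnc
      have hvl : v ∈ e :: l := by rw [← List.mem_toFinset, hlT]; exact hv
      obtain ⟨l₁, l₂, h12⟩ := List.append_of_mem hvl
      have hnew : ∃ l', e :: l' = l₁ ++ v :: u :: v :: l₂ := by
        rcases l₁ with _ | ⟨a, l₁⟩
        · simp only [List.nil_append, List.cons.injEq] at h12 ⊢
          exact ⟨_, h12.1, rfl⟩
        · simp only [List.cons_append, List.cons.injEq] at h12 ⊢
          exact ⟨_, h12.1, rfl⟩
      obtain ⟨l', hl'⟩ := hnew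
      refine ⟨insert u T, Finset.insert_subset hu hTS, by
        rw [Finset.card_insert_of_notMem huT, hcard], l', ?_, ?_, ?_⟩
      · rw [h12, List.isChain_split] at hl
        rw [hl', List.isChain_split]
        exact ⟨hl.1, List.isChain_cons_cons.2 ⟨huv,
          List.isChain_cons_cons.2 ⟨edgeNbrs_symm huv, hl.2⟩⟩⟩
      · rw [← hlT, hl', h12]
        ext x
        simp only [List.mem_toFinset, List.mem_append, List.mem_cons, Finset.mem_insert]
        tauto
      · have := congrArg List.length hl'
        have h3 := congrArg List.length h12
        simp only [List.length_cons, List.length_append] at this h3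
        omega
  have hpos : 0 < S.card := Finset.card_pos.2 ⟨e, he⟩
  obtain ⟨T, hTS, hcard, l, hl, hlT, hlen⟩ := key (S.card - 1) (by omega)
  have hT : T = S := Finset.eq_of_subset_of_card_le hTS (by omega)
  rw [Finset.mem_image]
  refine ⟨e :: l, ?_, by rw [hlT, hT]⟩
  rw [← hlen]
  exact mem_edgeWalks l e hl

/-- The horizontal edges of the row `r` whose first endpoint is within distance `n` of `(k, r)`
or of `(k', r)`; near the border the truncated subtraction is what is wanted. -/
def nearEdges (r k k' n : ℕ) : Finset GridEdge :=
  (Finset.Icc (k - n) (k + n) ∪ Finset.Icc (k' - n) (k' + n)).image fun i => (i, r, false)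

lemma card_nearEdges_le {n : ℕ} (hn : 0 < n) (r k k' : ℕ) : (nearEdges r k k' n).card ≤ 6 * n := by
  refine Finset.card_image_le.trans ((Finset.card_union_le _ _).trans ?_)
  simp only [Nat.card_Icc]
  omega

lemma exists_column_free {L n k : ℕ} {S : Finset GridEdge} (hn : S.card = n) (hnL : n < L)
    (hk : k < L) : ∃ i < L, k - n ≤ i ∧ i ≤ k + n ∧ ∀ j, (i, j, true) ∉ S := by
  by_contra! hcon
  set a := min k (L - 1 - n) with ha
  have hsub : Finset.Icc a (a + n) ⊆ S.image Prod.fst := by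
    intro i hi
    rw [Finset.mem_Icc] at hi
    obtain ⟨j, hj⟩ := hcon i (by omega) (by omega) (by omega)
    exact Finset.mem_image.2 ⟨_, hj, rfl⟩
  have := (Finset.card_le_card hsub).trans Finset.card_image_le
  rw [Nat.card_Icc] at this
  omega

lemma exists_row_free {L n : ℕ} {S : Finset GridEdge} (hn : S.card = n) (hnL : n < L) :
    ∃ j < L, ∀ i, (i, j, false) ∉ S := by
  by_contra! hcon
  have hsub : Finset.range L ⊆ S.image fun e => e.2.1 := by
    intro j hj
    obtain ⟨i, hi⟩ := hcon j (Finset.mem_range.1 hj)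
    exact Finset.mem_image.2 ⟨_, hi, rfl⟩
  have := (Finset.card_le_card hsub).trans Finset.card_image_le
  rw [Finset.card_range] at this
  omega

/-- A contour of length `n` that separates two sites of a row meets the row within distance `n`
of one of them: if `n < L`, some row and, near each of the two sites, some column avoid the
contour, and these lines join the two sites up to their short pieces of the row. -/
lemma exists_mem_nearEdges {L r k k' : ℕ} {S : Finset GridEdge} (hS : IsCocycle L S)
    (hr : r < L) (hk : k < L) (hk' : k' < L) (hsep : potential S k r ≠ potential S k' r) :
    ∃ e ∈ nearEdges r k k' S.card, e ∈ S := by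
  by_contra! hcon
  apply hsep
  set n := S.card with hn
  set t := potential S with ht
  have hgf : ∀ i j, i + 1 < L → j < L → (i, j, false) ∉ S → grad t (i, j, false) = 1 :=
    fun i j hi hj h => by
      rw [ht, grad_potential hS (mem_gridEdges_false.2 ⟨hi, hj⟩)]; simp [edgeSign, h]
  have hgt : ∀ i j, i < L → j + 1 < L → (i, j, true) ∉ S → grad t (i, j, true) = 1 :=
    fun i j hi hj h => by
      rw [ht, grad_potential hS (mem_gridEdges_true.2 ⟨hi, hj⟩)]; simp [edgeSign, h]
  have hrow : ∀ a b j, a < L → b < L → j < L →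
      (∀ i, min a b ≤ i → i < max a b → (i, j, false) ∉ S) → t a j = t b j := by
    intro a b j ha hb hj h
    rcases le_total a b with hab | hab
    · exact row_eq b hab fun i h1 h2 =>
        hgf i j (by omega) hj (h i (by omega) (by omega))
    · exact (row_eq a hab fun i h1 h2 =>
        hgf i j (by omega) hj (h i (by omega) (by omega))).symm
  have hcol : ∀ a b i, a < L → b < L → i < L →
      (∀ j, (i, j, true) ∉ S) → t i a = t i b := by
    intro a b i ha hb hi h
    rcases le_total a b with hab | hab
    · exact col_eq b hab fun j h1 h2 => hgt i j hi (by omega) (h j)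
    · exact (col_eq a hab fun j h1 h2 => hgt i j hi (by omega) (h j)).symm
  have hnear : ∀ i, (k - n ≤ i ∧ i ≤ k + n) ∨ (k' - n ≤ i ∧ i ≤ k' + n) → (i, r, false) ∉ S := by
    intro i hi
    refine hcon _ (Finset.mem_image.2 ⟨i, ?_, rfl⟩)
    simpa only [Finset.mem_union, Finset.mem_Icc] using hi
  rcases lt_or_ge n L with hnL | hnL
  · obtain ⟨i, hi, hi1, hi2, hi3⟩ := exists_column_free hn.symm hnL hk
    obtain ⟨i', hi', hi1', hi2', hi3'⟩ := exists_column_free hn.symm hnL hk'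
    obtain ⟨j, hj, hj'⟩ := exists_row_free hn.symm hnL
    calc t k r = t i r := hrow _ _ _ hk hi hr fun m h1 h2 => hnear m (Or.inl (by omega))
      _ = t i j := hcol _ _ _ hr hj hi hi3
      _ = t i' j := hrow _ _ _ hi hi' hj fun m _ _ => hj' m
      _ = t i' r := hcol _ _ _ hj hr hi' hi3'
      _ = t k' r := hrow _ _ _ hi' hk' hr fun m h1 h2 => hnear m (Or.inr (by omega))
  · exact hrow _ _ _ hk hk' hr fun m h1 h2 => hnear m (Or.inl (by omega))

open scoped Classical in
/-- The connected contours in the grid of side `L` that separate `(k, r)` from `(k', r)`. -/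
def contours (L r k k' : ℕ) : Finset (Finset GridEdge) :=
  (gridEdges L).powerset.filter fun S =>
    IsCocycle L S ∧ EdgeConn S ∧ potential S k r ≠ potential S k' r

lemma card_pos_of_potential_ne {S : Finset GridEdge} {i j i' j' : ℕ}
    (h : potential S i j ≠ potential S i' j') : 0 < S.card := by
  rw [Finset.card_pos, Finset.nonempty_iff_ne_empty]
  rintro rfl
  exact h (by simp [potential, edgeSign])

/-- There are at most `6 n ≤ 6 * 2 ^ n` edges near the two sites to start from, and at most
`8 ^ (2 (n - 1)) ≤ 64 ^ n` connected sets of `n` edges through each. -/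
lemma card_contours_le {L r k k' : ℕ} (hr : r < L) (hk : k < L) (hk' : k' < L) (n : ℕ) :
    ((contours L r k k').filter fun S => S.card = n).card ≤ 6 * 128 ^ n := by
  rcases Nat.eq_zero_or_pos n with rfl | hn
  · rw [Finset.filter_eq_empty_iff.2]
    · simp
    · intro S hS h0
      simp only [contours, Finset.mem_filter] at hS
      exact (card_pos_of_potential_ne hS.2.2.2).ne' h0
  have hsub : (contours L r k k').filter (fun S => S.card = n) ⊆
      (nearEdges r k k' n).biUnion fun e => (edgeWalks (2 * (n - 1)) e).image List.toFinset := by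
    intro S hS
    simp only [contours, Finset.mem_filter] at hS
    obtain ⟨⟨-, h1, h2, h3⟩, h4⟩ := hS
    obtain ⟨e, he, heS⟩ := exists_mem_nearEdges h1 hr hk hk' h3
    rw [h4] at he
    refine Finset.mem_biUnion.2 ⟨e, he, ?_⟩
    have := h2.exists_walk heS
    rwa [h4] at this
  calc _ ≤ (nearEdges r k k' n).card * 8 ^ (2 * (n - 1)) :=
        (Finset.card_le_card hsub).trans (Finset.card_biUnion_le_card_mul _ _ _ fun e _ =>
          Finset.card_image_le.trans (card_edgeWalks_le _ _))
    _ ≤ (6 * 2 ^ n) * 64 ^ n := by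
        refine Nat.mul_le_mul ?_ ?_
        · exact (card_nearEdges_le hn r k k').trans (Nat.mul_le_mul_left _ Nat.lt_two_pow_self.le)
        · calc 8 ^ (2 * (n - 1)) ≤ 8 ^ (2 * n) := Nat.pow_le_pow_right (by norm_num) (by omega)
            _ = 64 ^ n := by rw [pow_mul]; norm_num
    _ = 6 * 128 ^ n := by rw [mul_assoc, ← mul_pow]; norm_num

lemma sum_pow_succ_le {x : ℝ} (h0 : 0 ≤ x) (h1 : x ≤ 1 / 2) (N : ℕ) :
    ∑ n ∈ Finset.range N, x ^ (n + 1) ≤ 2 * x := by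
  have key : ∑ n ∈ Finset.range N, x ^ (n + 1) + 2 * x ^ (N + 1) ≤ 2 * x := by
    induction N with
    | zero => simp
    | succ N ih =>
      rw [Finset.sum_range_succ]
      have : x ^ (N + 1 + 1) ≤ x ^ (N + 1) * (1 / 2) := by
        rw [pow_succ _ (N + 1)]
        exact mul_le_mul_of_nonneg_left h1 (by positivity)
      linarith
  have : 0 ≤ x ^ (N + 1) := by positivity
  linarith

lemma sum_contours_le {L r k k' : ℕ} (hr : r < L) (hk : k < L) (hk' : k' < L) {z : ℝ}
    (h0 : 0 ≤ z) (h1 : 128 * z ≤ 1 / 2) :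
    ∑ S ∈ contours L r k k', z ^ S.card ≤ 1536 * z := by
  have hmaps : ∀ S ∈ contours L r k k', S.card - 1 ∈ Finset.range ((gridEdges L).card + 1) := by
    intro S hS
    simp only [contours, Finset.mem_filter, Finset.mem_powerset] at hS
    have := Finset.card_le_card hS.1
    rw [Finset.mem_range]
    omega
  rw [← Finset.sum_fiberwise_of_maps_to hmaps]
  calc _ ≤ ∑ n ∈ Finset.range ((gridEdges L).card + 1), 6 * (128 * z) ^ (n + 1) := by
        refine Finset.sum_le_sum fun n _ => ?_
        have hfil : (contours L r k k').filter (fun S => S.card - 1 = n) =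
            (contours L r k k').filter fun S => S.card = n + 1 := by
          refine Finset.filter_congr fun S hS => ?_
          simp only [contours, Finset.mem_filter] at hS
          have := card_pos_of_potential_ne hS.2.2.2
          omega
        rw [hfil, Finset.sum_congr rfl (g := fun _ => z ^ (n + 1)) fun S hS => by
          rw [(Finset.mem_filter.1 hS).2], Finset.sum_const, nsmul_eq_mul]
        have hc : (((contours L r k k').filter fun S => S.card = n + 1).card : ℝ) ≤
            6 * 128 ^ (n + 1) := by exact_mod_cast card_contours_le hr hk hk' (n + 1)
        calc _ ≤ 6 * 128 ^ (n + 1) * z ^ (n + 1) :=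
              mul_le_mul_of_nonneg_right hc (by positivity)
          _ = _ := by rw [mul_pow]; ring
    _ ≤ 6 * (2 * (128 * z)) := by
        rw [← Finset.mul_sum]
        exact mul_le_mul_of_nonneg_left (sum_pow_succ_le (by positivity) h1 _) (by norm_num)
    _ = 1536 * z := by ring

/-! ### The Peierls bound -/

section Peierls

variable {ι : Type*}

/-- The ferromagnetic nearest-neighbour interaction on a copy of the grid in `ι`. -/
def gridInteraction (L : ℕ) (f : ℕ → ℕ → ι) (s : ι → ℤˣ) : ℝ :=
  ∑ e ∈ gridEdges L, ((grad (fun i j => s (f i j)) e : ℤ) : ℝ)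

open scoped Classical in
/-- The field `potential S`, transported to `ι` and extended by `1`. -/
def gridFlip (L : ℕ) (f : ℕ → ℕ → ι) (S : Finset GridEdge) (p : ι) : ℤˣ :=
  if ∃ i < L, ∃ j < L, f i j = p ∧ potential S i j = -1 then -1 else 1

lemma gridFlip_apply {L : ℕ} {f : ℕ → ℕ → ι}
    (hf : ∀ i j i' j', i < L → j < L → i' < L → j' < L → f i j = f i' j' → i = i' ∧ j = j')
    (S : Finset GridEdge) {i j : ℕ} (hi : i < L) (hj : j < L) :
    gridFlip L f S (f i j) = potential S i j := by
  unfold gridFlip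
  split_ifs with h
  · obtain ⟨i', hi', j', hj', h1, h2⟩ := h
    obtain ⟨rfl, rfl⟩ := hf _ _ _ _ hi' hj' hi hj h1
    exact h2.symm
  · rcases Int.units_eq_one_or (potential S i j) with h1 | h1
    · exact h1.symm
    · exact absurd ⟨i, hi, j, hj, rfl, h1⟩ h

/-- Flipping the spins on one side of a contour made of unsatisfied edges satisfies those edges
and changes no other edge. -/
lemma gridInteraction_flip {L : ℕ} {f : ℕ → ℕ → ι}
    (hf : ∀ i j i' j', i < L → j < L → i' < L → j' < L → f i j = f i' j' → i = i' ∧ j = j')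
    {S : Finset GridEdge} (hS : IsCocycle L S) {s : ι → ℤˣ}
    (hsub : S ⊆ badEdges L fun i j => s (f i j)) :
    gridInteraction L f (fun p => s p * gridFlip L f S p) =
      gridInteraction L f s + 2 * S.card := by
  have hSg : S ⊆ gridEdges L := hsub.trans (Finset.filter_subset _ _)
  have h1 : ∀ e ∈ gridEdges L, ((grad (fun i j => s (f i j) * gridFlip L f S (f i j)) e : ℤ) : ℝ) =
      ((grad (fun i j => s (f i j)) e : ℤ) : ℝ) + if e ∈ S then 2 else 0 := by
    intro e he
    obtain ⟨⟨ha, hb⟩, hc, hd⟩ := mem_gridEdges.1 he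
    have : grad (fun i j => gridFlip L f S (f i j)) e = edgeSign S e := by
      rw [← grad_potential hS he]
      simp only [grad, gridFlip_apply hf S ha hb, gridFlip_apply hf S hc hd]
    rw [grad_mul (fun i j => s (f i j)), this]
    by_cases heS : e ∈ S
    · have h2 := (Finset.mem_filter.1 (hsub heS)).2
      rw [h2]
      simp [edgeSign, heS]
      norm_num
    · simp [edgeSign, heS]
  unfold gridInteraction
  rw [Finset.sum_congr rfl h1, Finset.sum_add_distrib, ← Finset.sum_filter,
    Finset.filter_mem_eq_inter, Finset.inter_eq_right.2 hSg, Finset.sum_const, nsmul_eq_mul]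
  ring

/-- The Peierls bound: at low temperature two sites of a row of the grid rarely have opposite
spins, uniformly in the size of the grid and in the two sites. -/
theorem peierls_bound [Fintype ι] [DecidableEq ι] {L r k k' : ℕ} {f : ℕ → ℕ → ι}
    (hf : ∀ i j i' j', i < L → j < L → i' < L → j' < L → f i j = f i' j' → i = i' ∧ j = j')
    (hr : r < L) (hk : k < L) (hk' : k' < L) {β : ℝ}
    (hβ : 128 * Real.exp (-(2 * β)) ≤ 1 / 2) :
    ∑ s : ι → ℤˣ, (if s (f k r) ≠ s (f k' r) then Real.exp (β * gridInteraction L f s) else 0) ≤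
      1536 * Real.exp (-(2 * β)) * ∑ s : ι → ℤˣ, Real.exp (β * gridInteraction L f s) := by
  set w : (ι → ℤˣ) → ℝ := fun s => Real.exp (β * gridInteraction L f s) with hw
  have hw0 : ∀ s, 0 ≤ w s := fun s => (Real.exp_pos _).le
  set bad : (ι → ℤˣ) → Finset GridEdge := fun s => badEdges L fun i j => s (f i j) with hbad
  calc _ ≤ ∑ s : ι → ℤˣ, ∑ S ∈ contours L r k k', if S ⊆ bad s then w s else 0 := by
        refine Finset.sum_le_sum fun s _ => ?_
        split_ifs with h
        · obtain ⟨S, hS, h1, h2, h3⟩ := exists_connected_contour (bad s) (isCocycle_badEdges L _)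
            (potential_badEdges_ne (fun i j => s (f i j)) hk hr hk' hr h)
          have hmem : S ∈ contours L r k k' := by
            simp only [contours, Finset.mem_filter, Finset.mem_powerset]
            exact ⟨hS.trans (Finset.filter_subset _ _), h1, h2, h3⟩
          refine le_trans ?_ (Finset.single_le_sum (fun T _ => ?_) hmem)
          · rw [if_pos hS]
          · split_ifs <;> [exact hw0 s; exact le_rfl]
        · exact Finset.sum_nonneg fun T _ => by split_ifs <;> [exact hw0 s; exact le_rfl]
    _ = ∑ S ∈ contours L r k k', ∑ s : ι → ℤˣ, if S ⊆ bad s then w s else 0 := Finset.sum_comm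
    _ ≤ ∑ S ∈ contours L r k k', Real.exp (-(2 * β)) ^ S.card * ∑ s, w s := by
        refine Finset.sum_le_sum fun S hS => ?_
        have hc : IsCocycle L S := by
          simp only [contours, Finset.mem_filter] at hS
          exact hS.2.1
        set τ : ι → ℤˣ := gridFlip L f S with hτ
        have hsum : ∑ s, w s = ∑ s, w (s * τ) :=
          (Equiv.sum_comp (Equiv.mulRight τ) w).symm
        rw [hsum, Finset.mul_sum]
        refine Finset.sum_le_sum fun s _ => ?_
        split_ifs with h
        · have h2 : w (s * τ) = w s * Real.exp (2 * β) ^ S.card := by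
            have hflip := gridInteraction_flip hf hc h
            change Real.exp (β * gridInteraction L f (fun p => s p * gridFlip L f S p)) =
              Real.exp (β * gridInteraction L f s) * _
            rw [hflip, ← Real.exp_nat_mul, ← Real.exp_add]
            congr 1
            ring
          rw [h2, mul_left_comm, ← mul_pow, ← Real.exp_add]
          simp
        · exact mul_nonneg (by positivity) (hw0 _)
    _ = (∑ S ∈ contours L r k k', Real.exp (-(2 * β)) ^ S.card) * ∑ s, w s := by
        rw [Finset.sum_mul]
    _ ≤ _ := mul_le_mul_of_nonneg_right (sum_contours_le hr hk hk' (Real.exp_pos _).le hβ)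
        (Finset.sum_nonneg fun s _ => hw0 s)

end Peierls

/-! ### Griffiths inequalities -/

section Griffiths

variable {d : ℕ} {Λ : Finset (Site d)}

/-- `f` is a combination of the monomials `s_[A]` with non-negative coefficients. -/
def Ferromagnetic (f : SpinConfig Λ → ℝ) : Prop :=
  ∃ c : Finset Λ → ℝ, (∀ A, 0 ≤ c A) ∧ ∀ s, f s = ∑ A, c A * spinProd A s

lemma unit_mul_self_real (u : ℤˣ) : ((u : ℤ) : ℝ) * ((u : ℤ) : ℝ) = 1 := by
  rcases Int.units_eq_one_or u with rfl | rfl <;> simp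

lemma spinProd_mul_config (A : Finset Λ) (s t : SpinConfig Λ) :
    spinProd A (s * t) = spinProd A s * spinProd A t := by
  simp [spinProd, Finset.prod_mul_distrib]

lemma spinProd_mul_self (A : Finset Λ) (s : SpinConfig Λ) : spinProd A s * spinProd A s = 1 := by
  rw [spinProd, ← Finset.prod_mul_distrib]
  exact Finset.prod_eq_one fun x _ => unit_mul_self_real _

lemma abs_spinProd (A : Finset Λ) (s : SpinConfig Λ) : |spinProd A s| = 1 := by
  have h := spinProd_mul_self A s
  rw [← abs_mul_abs_self] at h
  nlinarith [abs_nonneg (spinProd A s)]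

lemma spinProd_union_of_disjoint {A B : Finset Λ} (h : Disjoint A B) (s : SpinConfig Λ) :
    spinProd (A ∪ B) s = spinProd A s * spinProd B s := Finset.prod_union h

/-- The monomials form a group: `s_[A] s_[B] = s_[A ∆ B]`. -/
lemma spinProd_mul (A B : Finset Λ) (s : SpinConfig Λ) :
    spinProd A s * spinProd B s = spinProd ((A \ B) ∪ (B \ A)) s := by
  rw [spinProd_union_of_disjoint (disjoint_sdiff_sdiff)]
  have h1 : spinProd A s = spinProd (A \ B) s * spinProd (A ∩ B) s := by
    rw [← spinProd_union_of_disjoint (Finset.disjoint_sdiff_inter A B), Finset.sdiff_union_inter]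
  have h2 : spinProd B s = spinProd (B \ A) s * spinProd (A ∩ B) s := by
    rw [Finset.inter_comm A B,
      ← spinProd_union_of_disjoint (Finset.disjoint_sdiff_inter B A), Finset.sdiff_union_inter]
  rw [h1, h2, mul_mul_mul_comm, spinProd_mul_self, mul_one]

lemma spinProd_singleton (x : Λ) (s : SpinConfig Λ) : spinProd {x} s = ((s x : ℤ) : ℝ) := by
  simp [spinProd]

lemma spinProd_pair {x y : Λ} (h : x ≠ y) (s : SpinConfig Λ) :
    spinProd {x, y} s = ((s x : ℤ) : ℝ) * ((s y : ℤ) : ℝ) := by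
  simp [spinProd, Finset.prod_pair h]

namespace Ferromagnetic

lemma monomial (A : Finset Λ) : Ferromagnetic (spinProd A) := by
  refine ⟨fun B => if B = A then 1 else 0, fun B => by positivity, fun s => ?_⟩
  simp

lemma zero : Ferromagnetic (fun _ : SpinConfig Λ => (0 : ℝ)) :=
  ⟨fun _ => 0, fun _ => le_rfl, fun s => by simp⟩

lemma add {f g : SpinConfig Λ → ℝ} (hf : Ferromagnetic f) (hg : Ferromagnetic g) :
    Ferromagnetic fun s => f s + g s := by
  obtain ⟨c, hc, h⟩ := hf
  obtain ⟨c', hc', h'⟩ := hg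
  refine ⟨fun A => c A + c' A, fun A => add_nonneg (hc A) (hc' A), fun s => ?_⟩
  simp only [h, h']
  rw [← Finset.sum_add_distrib]
  simp only [add_mul]

lemma const_mul {f : SpinConfig Λ → ℝ} (hf : Ferromagnetic f) {a : ℝ} (ha : 0 ≤ a) :
    Ferromagnetic fun s => a * f s := by
  obtain ⟨c, hc, h⟩ := hf
  refine ⟨fun A => a * c A, fun A => mul_nonneg ha (hc A), fun s => ?_⟩
  simp only [h]
  rw [Finset.mul_sum]
  simp only [mul_assoc]

lemma sum {κ : Type*} (T : Finset κ) {f : κ → SpinConfig Λ → ℝ}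
    (hf : ∀ i ∈ T, Ferromagnetic (f i)) : Ferromagnetic fun s => ∑ i ∈ T, f i s := by
  classical
  induction T using Finset.induction_on with
  | empty => simpa using zero
  | insert i T hi ih =>
    simp only [Finset.sum_insert hi]
    exact (hf i (Finset.mem_insert_self _ _)).add
      (ih fun j hj => hf j (Finset.mem_insert_of_mem hj))

lemma mul {f g : SpinConfig Λ → ℝ} (hf : Ferromagnetic f) (hg : Ferromagnetic g) :
    Ferromagnetic fun s => f s * g s := by
  obtain ⟨c, hc, h⟩ := hf
  obtain ⟨c', hc', h'⟩ := hg
  have : (fun s => f s * g s) =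
      fun s => ∑ A, ∑ B, c A * (c' B * spinProd ((A \ B) ∪ (B \ A)) s) := by
    funext s
    rw [h, h', Finset.sum_mul_sum]
    refine Finset.sum_congr rfl fun A _ => Finset.sum_congr rfl fun B _ => ?_
    rw [← spinProd_mul]; ring
  rw [this]
  exact sum _ fun A _ => sum _ fun B _ => ((monomial _).const_mul (hc' B)).const_mul (hc A)

lemma const {a : ℝ} (ha : 0 ≤ a) : Ferromagnetic fun _ : SpinConfig Λ => a := by
  have := (monomial (∅ : Finset Λ)).const_mul ha
  simpa [spinProd] using this

lemma prod {κ : Type*} (T : Finset κ) {f : κ → SpinConfig Λ → ℝ}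
    (hf : ∀ i ∈ T, Ferromagnetic (f i)) : Ferromagnetic fun s => ∏ i ∈ T, f i s := by
  classical
  induction T using Finset.induction_on with
  | empty => simpa using const zero_le_one
  | insert i T hi ih =>
    simp only [Finset.prod_insert hi]
    exact (hf i (Finset.mem_insert_self _ _)).mul
      (ih fun j hj => hf j (Finset.mem_insert_of_mem hj))

/-- The Boltzmann factor is ferromagnetic, as
`exp (c s_[A]) = cosh c + (sinh c) s_[A]` for each term of the interaction. -/
lemma exp {f : SpinConfig Λ → ℝ} (hf : Ferromagnetic f) :
    Ferromagnetic fun s => Real.exp (f s) := by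
  obtain ⟨c, hc, h⟩ := hf
  simp only [h, Real.exp_sum]
  refine prod _ fun A _ => ?_
  have : (fun s => Real.exp (c A * spinProd A s)) =
      fun s => Real.cosh (c A) + Real.sinh (c A) * spinProd A s := by
    funext s
    rcases eq_or_eq_neg_of_abs_eq (abs_spinProd A s) with h | h <;> rw [h]
    · rw [mul_one, mul_one, Real.cosh_add_sinh]
    · rw [mul_neg_one, mul_neg_one, ← sub_eq_add_neg, Real.cosh_sub_sinh]
  rw [this]
  exact (const (Real.cosh_pos _).le).add
    ((monomial A).const_mul (Real.sinh_nonneg_iff.2 (hc A)))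

lemma sum_spinProd_nonneg (A : Finset Λ) : 0 ≤ ∑ s : SpinConfig Λ, spinProd A s := by
  rcases A.eq_empty_or_nonempty with rfl | ⟨x, hx⟩
  · simp [spinProd]
  · -- reversing the spin at a site of `A` changes the sign of the sum
    set τ : SpinConfig Λ := Pi.mulSingle x (-1) with hτ
    have h1 : spinProd A τ = -1 := by
      rw [spinProd, Finset.prod_eq_single x (fun y _ hy => by simp [hτ, Pi.mulSingle_eq_of_ne hy])
        (fun h => absurd hx h)]
      simp [hτ]
    have h2 : ∑ s : SpinConfig Λ, spinProd A (s * τ) = ∑ s, spinProd A s :=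
      Equiv.sum_comp (Equiv.mulRight τ) (spinProd A)
    simp only [spinProd_mul_config, h1, mul_neg_one, Finset.sum_neg_distrib] at h2
    linarith

lemma sum_nonneg {f : SpinConfig Λ → ℝ} (hf : Ferromagnetic f) : 0 ≤ ∑ s, f s := by
  obtain ⟨c, hc, h⟩ := hf
  simp only [h]
  rw [Finset.sum_comm]
  refine Finset.sum_nonneg fun A _ => ?_
  rw [← Finset.mul_sum]
  exact mul_nonneg (hc A) (sum_spinProd_nonneg A)

/-- The coefficients `c_A + c'_A (1 + t_[A])` of this interaction are non-negative, whatever the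
signs `t_[A]`. -/
lemma add_translate {f g : SpinConfig Λ → ℝ} (hf : Ferromagnetic f) (hg : Ferromagnetic g)
    (t : SpinConfig Λ) : Ferromagnetic fun s => f s + (g s + g (s * t)) := by
  refine hf.add ?_
  obtain ⟨c, hc, h⟩ := hg
  refine ⟨fun A => c A * (1 + spinProd A t), fun A => mul_nonneg (hc A) ?_, fun s => ?_⟩
  · linarith [neg_abs_le (spinProd A t), abs_spinProd A t]
  · simp only [h]
    rw [← Finset.sum_add_distrib]
    refine Finset.sum_congr rfl fun A _ => ?_
    rw [spinProd_mul_config]; ring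

/-- Griffiths' second inequality in its monotone form: a correlation does not decrease when a
ferromagnetic interaction `f` is added to a ferromagnetic interaction `g`. The proof doubles
the variables and substitutes `s' = s t`. -/
theorem correlation_mono {f g : SpinConfig Λ → ℝ} (hf : Ferromagnetic f) (hg : Ferromagnetic g)
    (A : Finset Λ) :
    (∑ s, spinProd A s * Real.exp (g s)) * ∑ s, Real.exp (f s + g s) ≤
      (∑ s, spinProd A s * Real.exp (f s + g s)) * ∑ s, Real.exp (g s) := by
  have h1 : (∑ s, spinProd A s * Real.exp (f s + g s)) * ∑ s, Real.exp (g s) -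
      (∑ s, spinProd A s * Real.exp (g s)) * ∑ s, Real.exp (f s + g s) =
      ∑ s : SpinConfig Λ, ∑ t : SpinConfig Λ,
        (spinProd A s - spinProd A t) * (Real.exp (f s + g s) * Real.exp (g t)) := by
    rw [mul_comm (∑ s, spinProd A s * Real.exp (g s)), Finset.sum_mul_sum, Finset.sum_mul_sum,
      ← Finset.sum_sub_distrib]
    refine Finset.sum_congr rfl fun s _ => ?_
    rw [← Finset.sum_sub_distrib]
    exact Finset.sum_congr rfl fun t _ => by ring
  have h2 : ∀ s : SpinConfig Λ, ∑ t : SpinConfig Λ,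
        (spinProd A s - spinProd A t) * (Real.exp (f s + g s) * Real.exp (g t)) =
      ∑ t : SpinConfig Λ, (1 - spinProd A t) *
        (spinProd A s * Real.exp (f s + (g s + g (s * t)))) := by
    intro s
    rw [← Equiv.sum_comp (Equiv.mulLeft s)]
    refine Finset.sum_congr rfl fun t _ => ?_
    rw [Equiv.coe_mulLeft, spinProd_mul_config, ← add_assoc, Real.exp_add _ (g (s * t))]
    ring
  rw [← sub_nonneg, h1, Finset.sum_congr rfl fun s _ => h2 s, Finset.sum_comm]
  refine Finset.sum_nonneg fun t _ => ?_
  rw [← Finset.mul_sum]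
  refine mul_nonneg ?_ (sum_nonneg ((monomial A).mul (exp (add_translate hf hg t))))
  linarith [le_abs_self (spinProd A t), abs_spinProd A t]

end Ferromagnetic

end Griffiths

/-! ### Gaussian integration over the oscillator variables -/

open MeasureTheory ProbabilityTheory in
lemma integral_sq_mul_gaussianPDFReal (m : ℝ) {v : NNReal} (hv : v ≠ 0) :
    ∫ t, t ^ 2 * gaussianPDFReal m v t = m ^ 2 + v := by
  have h1 : Var[fun t : ℝ => t; gaussianReal m v] = v := variance_fun_id_gaussianReal
  rw [variance_eq_sub (X := fun t : ℝ => t) (memLp_id_gaussianReal 2)] at h1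
  have h2 : ∫ t, t ∂(gaussianReal m v) = m := integral_id_gaussianReal
  simp only [Pi.pow_apply, h2] at h1
  rw [integral_gaussianReal_eq_integral_smul hv] at h1
  simp only [smul_eq_mul] at h1
  simp only [mul_comm (_ ^ 2)]
  linarith

open MeasureTheory ProbabilityTheory in
lemma integral_mul_gaussianPDFReal (m : ℝ) {v : NNReal} (hv : v ≠ 0) :
    ∫ t, t * gaussianPDFReal m v t = m := by
  have h2 : ∫ t, t ∂(gaussianReal m v) = m := integral_id_gaussianReal
  rw [integral_gaussianReal_eq_integral_smul hv] at h2
  simp only [smul_eq_mul] at h2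
  simpa only [mul_comm] using h2

namespace SpinOscModel

variable {d : ℕ} (M : SpinOscModel d) (Λ : Finset (Site d))

/-- The variance `1 / (2 μ)` of the oscillator ground state. -/
def oscVar : NNReal := ⟨1 / (2 * M.μ), by have := M.μ_pos; positivity⟩

lemma oscVar_ne_zero : M.oscVar ≠ 0 := by
  have h : (M.oscVar : ℝ) ≠ 0 := by
    have := M.μ_pos
    change 1 / (2 * M.μ) ≠ 0
    positivity
  exact_mod_cast h

lemma ψ₀_sq_mul_exp (m t : ℝ) : M.ψ₀ t ^ 2 * Real.exp (-(2 * M.μ * t * m)) =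
    Real.exp (M.μ * m ^ 2) * ProbabilityTheory.gaussianPDFReal (-m) M.oscVar t := by
  have hμ := M.μ_pos
  have hv : (M.oscVar : ℝ) = 1 / (2 * M.μ) := rfl
  have h1 : ((M.μ / Real.pi) ^ (1 / 4 : ℝ)) ^ 2 = (√(2 * Real.pi * M.oscVar))⁻¹ := by
    rw [hv, ← Real.rpow_natCast, ← Real.rpow_mul (by positivity), ← Real.sqrt_inv,
      Real.sqrt_eq_rpow]
    congr 1
    · field_simp
    · norm_num
  rw [ProbabilityTheory.gaussianPDFReal, ψ₀, mul_pow, h1, hv, ← Real.exp_nat_mul, mul_assoc,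
    mul_left_comm (Real.exp _), ← Real.exp_add, ← Real.exp_add]
  congr 2
  push_cast
  field_simp
  ring

lemma integral_ψ₀_sq (m : ℝ) :
    ∫ t, M.ψ₀ t ^ 2 * Real.exp (-(2 * M.μ * t * m)) = Real.exp (M.μ * m ^ 2) := by
  simp only [ψ₀_sq_mul_exp]
  rw [MeasureTheory.integral_const_mul,
    ProbabilityTheory.integral_gaussianPDFReal_eq_one _ M.oscVar_ne_zero, mul_one]

lemma integral_mul_ψ₀_sq (m : ℝ) :
    ∫ t, t * (M.ψ₀ t ^ 2 * Real.exp (-(2 * M.μ * t * m))) = -m * Real.exp (M.μ * m ^ 2) := by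
  simp only [ψ₀_sq_mul_exp, mul_left_comm _ (Real.exp _)]
  rw [MeasureTheory.integral_const_mul, integral_mul_gaussianPDFReal _ M.oscVar_ne_zero]
  ring

lemma integral_sq_mul_ψ₀_sq (m : ℝ) :
    ∫ t, t ^ 2 * (M.ψ₀ t ^ 2 * Real.exp (-(2 * M.μ * t * m))) =
      (m ^ 2 + 1 / (2 * M.μ)) * Real.exp (M.μ * m ^ 2) := by
  simp only [ψ₀_sq_mul_exp, mul_left_comm _ (Real.exp _)]
  rw [MeasureTheory.integral_const_mul, integral_sq_mul_gaussianPDFReal _ M.oscVar_ne_zero]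
  have hv : (M.oscVar : ℝ) = 1 / (2 * M.μ) := rfl
  rw [hv]
  ring

/-- The components of `Ψ_Λ` as real numbers. -/
def ΨR (q : OscConfig Λ) (s : SpinConfig Λ) : ℝ :=
  Real.exp (-(1 / 2) * M.U Λ s q) * ∏ x : Λ, M.ψ₀ (q x)

lemma Ψ_eq (q : OscConfig Λ) (s : SpinConfig Λ) : M.Ψ Λ q s = (M.ΨR Λ q s : ℂ) := rfl

/-- The mean displacement `η (φ_x(s) + φ_x(s')) / 2` of two spin configurations. -/
def meanShift (s s' : SpinConfig Λ) (x : Λ) : ℝ := M.η * ((M.φ Λ x s + M.φ Λ x s') / 2)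

lemma ΨR_mul (q : OscConfig Λ) (s s' : SpinConfig Λ) : M.ΨR Λ q s * M.ΨR Λ q s' =
    Real.exp (-((M.U0 Λ s + M.U0 Λ s') / 2)) *
      ∏ x, M.ψ₀ (q x) ^ 2 * Real.exp (-(2 * M.μ * q x * M.meanShift Λ s s' x)) := by
  rw [ΨR, ΨR, mul_mul_mul_comm, ← Real.exp_add, Finset.prod_mul_distrib, ← Real.exp_sum,
    ← Finset.prod_mul_distrib, mul_left_comm, mul_comm, ← Real.exp_add]
  simp only [sq]
  congr 2
  simp only [U, meanShift, Finset.mul_sum]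
  rw [mul_add, mul_add, add_add_add_comm, add_comm]
  congr 1
  · ring
  · rw [Finset.mul_sum, Finset.mul_sum, ← Finset.sum_add_distrib]
    exact Finset.sum_congr rfl fun x _ => by ring

/-- The overlap of the components of `Ψ_Λ` at `s` and `s'`. -/
def overlap (s s' : SpinConfig Λ) : ℝ :=
  Real.exp (-((M.U0 Λ s + M.U0 Λ s') / 2)) *
    ∏ x, Real.exp (M.μ * M.meanShift Λ s s' x ^ 2)

lemma integral_ΨR_mul (s s' : SpinConfig Λ) :
    ∫ q, M.ΨR Λ q s * M.ΨR Λ q s' = M.overlap Λ s s' := by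
  simp only [ΨR_mul]
  rw [MeasureTheory.integral_const_mul, MeasureTheory.integral_fintype_prod_volume_eq_prod
    (fun x t => M.ψ₀ t ^ 2 * Real.exp (-(2 * M.μ * t * M.meanShift Λ s s' x)))]
  simp only [integral_ψ₀_sq, overlap]

lemma meanShift_self (s : SpinConfig Λ) (x : Λ) : M.meanShift Λ s s x = M.η * M.φ Λ x s := by
  simp [meanShift]

/-- Minus the effective spin energy, `μ η² ∑_x φ_x(s)² - U⁰(s)`. -/
def spinInteraction (s : SpinConfig Λ) : ℝ :=
  M.μ * M.η ^ 2 * ∑ x, M.φ Λ x s ^ 2 - M.U0 Λ s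

lemma overlap_self (s : SpinConfig Λ) :
    M.overlap Λ s s = Real.exp (M.spinInteraction Λ s) := by
  rw [overlap, ← Real.exp_sum, ← Real.exp_add]
  congr 1
  simp only [meanShift_self, spinInteraction, Finset.mul_sum]
  have : ∑ x, M.μ * (M.η * M.φ Λ x s) ^ 2 = ∑ x, M.μ * M.η ^ 2 * M.φ Λ x s ^ 2 :=
    Finset.sum_congr rfl fun x _ => by ring
  rw [this]
  ring

/-- Integrating out the oscillators in `q_x q_y`: `η² φ_x φ_y`, plus the variance if `x = y`. -/
lemma integral_mul_mul_ΨR_sq (x y : Λ) (s : SpinConfig Λ) :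
    ∫ q, q x * q y * (M.ΨR Λ q s * M.ΨR Λ q s) =
      (M.η ^ 2 * (M.φ Λ x s * M.φ Λ y s) + if x = y then 1 / (2 * M.μ) else 0) *
        M.overlap Λ s s := by
  set g : Λ → ℝ → ℝ := fun z t =>
    M.ψ₀ t ^ 2 * Real.exp (-(2 * M.μ * t * M.meanShift Λ s s z)) with hg
  set h : Λ → ℝ → ℝ := fun z t => (if z = x then t else 1) * (if z = y then t else 1) * g z t
    with hh
  have h1 : ∀ q : OscConfig Λ, q x * q y * (M.ΨR Λ q s * M.ΨR Λ q s) =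
      Real.exp (-((M.U0 Λ s + M.U0 Λ s) / 2)) * ∏ z, h z (q z) := by
    intro q
    rw [ΨR_mul]
    simp only [hh, hg, Finset.prod_mul_distrib, Finset.prod_ite_eq', Finset.mem_univ, if_true]
    ring
  have h2 : ∀ z, ∫ t, h z t = (if z = x then -M.meanShift Λ s s x else 1) *
      (if z = y then -M.meanShift Λ s s y else 1) *
      Real.exp (M.μ * M.meanShift Λ s s z ^ 2) +
      if z = x ∧ z = y then 1 / (2 * M.μ) * Real.exp (M.μ * M.meanShift Λ s s z ^ 2) else 0 := by
    intro z
    by_cases hx : z = x <;> by_cases hy : z = y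
    · subst hx
      subst hy
      simp only [hh, hg, if_true, and_self, ← sq, integral_sq_mul_ψ₀_sq]
      ring
    · subst hx
      simp only [hh, hg, hy, if_true, if_false, mul_one, integral_mul_ψ₀_sq, and_false, add_zero]
    · subst hy
      simp only [hh, hg, hx, if_true, if_false, one_mul, integral_mul_ψ₀_sq, false_and, add_zero]
    · simp only [hh, hg, hx, hy, if_false, one_mul, integral_ψ₀_sq, false_and, add_zero]
  simp only [h1]
  rw [MeasureTheory.integral_const_mul, MeasureTheory.integral_fintype_prod_volume_eq_prod h,
    overlap]
  simp only [h2]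
  by_cases hxy : x = y
  · subst hxy
    rw [mul_left_comm]
    congr 1
    rw [← Finset.mul_prod_erase _ _ (Finset.mem_univ x),
      ← Finset.mul_prod_erase _ _ (Finset.mem_univ x)]
    have h3 : ∀ z ∈ Finset.univ.erase x, (if z = x then -M.meanShift Λ s s x else 1) *
        (if z = x then -M.meanShift Λ s s x else 1) *
        Real.exp (M.μ * M.meanShift Λ s s z ^ 2) +
        (if z = x ∧ z = x then 1 / (2 * M.μ) * Real.exp (M.μ * M.meanShift Λ s s z ^ 2) else 0) =
        Real.exp (M.μ * M.meanShift Λ s s z ^ 2) := by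
      intro z hz
      simp [Finset.ne_of_mem_erase hz]
    rw [Finset.prod_congr rfl h3]
    simp only [if_true, and_self, meanShift_self]
    ring
  · have h3 : ∀ z : Λ, ¬ (z = x ∧ z = y) := fun z h => hxy (h.1.symm.trans h.2)
    simp only [h3, hxy, if_false, add_zero, Finset.prod_mul_distrib, Finset.prod_ite_eq',
      Finset.mem_univ, if_true, meanShift_self]
    ring

lemma waveInner_Ψ (a : OscConfig Λ → SpinConfig Λ → ℝ) (T : WaveFn Λ → WaveFn Λ)
    (hT : ∀ q s, T (M.Ψ Λ) q s = (a q s : ℂ)) :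
    waveInner (M.Ψ Λ) (T (M.Ψ Λ)) = ((∑ s, ∫ q, M.ΨR Λ q s * a q s : ℝ) : ℂ) := by
  simp only [waveInner, hT, Ψ_eq, Complex.conj_ofReal, ← Complex.ofReal_mul,
    Complex.ofReal_sum]
  exact Finset.sum_congr rfl fun s _ => integral_complex_ofReal

/-- The partition function of the effective spin model. -/
def partition : ℝ := ∑ s, Real.exp (M.spinInteraction Λ s)

lemma partition_pos : 0 < M.partition Λ :=
  Finset.sum_pos (fun _ _ => Real.exp_pos _) Finset.univ_nonempty

lemma average_re (a : OscConfig Λ → SpinConfig Λ → ℝ) (T : WaveFn Λ → WaveFn Λ)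
    (hT : ∀ q s, T (M.Ψ Λ) q s = (a q s : ℂ)) :
    (M.average Λ T).re = (∑ s, ∫ q, M.ΨR Λ q s * a q s) / M.partition Λ := by
  have h := M.waveInner_Ψ Λ (M.ΨR Λ) id fun q s => rfl
  simp only [integral_ΨR_mul, overlap_self, id] at h
  rw [average, M.waveInner_Ψ Λ a T hT, h, ← Complex.ofReal_div, Complex.ofReal_re]
  rfl

lemma average_opS3_opS3 (x y : Λ) :
    (M.average Λ fun F => opS3 x (opS3 y F)).re =
      (∑ s : SpinConfig Λ, ((s x : ℤ) : ℝ) * ((s y : ℤ) : ℝ) *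
        Real.exp (M.spinInteraction Λ s)) / M.partition Λ := by
  rw [M.average_re Λ fun q s => ((s x : ℤ) : ℝ) * ((s y : ℤ) : ℝ) * M.ΨR Λ q s]
  · congr 1
    refine Finset.sum_congr rfl fun s _ => ?_
    simp only [mul_left_comm (M.ΨR Λ _ s)]
    rw [MeasureTheory.integral_const_mul, integral_ΨR_mul, overlap_self]
  · intro q s
    simp only [opS3, Ψ_eq]
    push_cast
    ring

lemma average_opQ_opQ (x y : Λ) :
    (M.average Λ fun F => opQ x (opQ y F)).re =
      (∑ s : SpinConfig Λ, (M.η ^ 2 * (M.φ Λ x s * M.φ Λ y s) +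
        if x = y then 1 / (2 * M.μ) else 0) * Real.exp (M.spinInteraction Λ s)) /
        M.partition Λ := by
  rw [M.average_re Λ fun q s => q x * q y * M.ΨR Λ q s]
  · congr 1
    refine Finset.sum_congr rfl fun s _ => ?_
    simp only [mul_left_comm (M.ΨR Λ _ s)]
    rw [integral_mul_mul_ΨR_sq, overlap_self]
  · intro q s
    simp only [opQ, Ψ_eq]
    push_cast
    ring

lemma average_opS1Prod (A : Finset Λ) :
    (M.average Λ (opS1Prod A)).re =
      (∑ s : SpinConfig Λ, M.overlap Λ s (flipSpins A s)) / M.partition Λ := by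
  rw [M.average_re Λ fun q s => M.ΨR Λ q (flipSpins A s)]
  · simp only [integral_ΨR_mul]
  · intro q s
    rfl

end SpinOscModel

/-! ### Order in `S¹` -/

section Flip

variable {d : ℕ} {Λ : Finset (Site d)}

lemma flipSpins_flipSpins (A : Finset Λ) (s : SpinConfig Λ) :
    flipSpins A (flipSpins A s) = s := by
  funext x
  by_cases h : x ∈ A <;> simp [flipSpins, h]

lemma flipSpins_singleton_singleton {x y : Λ} (h : x ≠ y) (s : SpinConfig Λ) :
    flipSpins {y} (flipSpins {x} s) = flipSpins {x, y} s := by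
  funext z
  by_cases h1 : z = x
  · subst h1
    simp [flipSpins, h]
  · simp [flipSpins, h1]

lemma spinProd_flipSpins_of_disjoint {A B : Finset Λ} (h : Disjoint B A) (s : SpinConfig Λ) :
    spinProd B (flipSpins A s) = spinProd B s :=
  Finset.prod_congr rfl fun x hx => by simp [flipSpins, Finset.disjoint_left.1 h hx]

end Flip

namespace SpinOscModel

variable {d : ℕ} (M : SpinOscModel d) (Λ : Finset (Site d))

lemma normJU_nonneg : 0 ≤ M.normJU := tsum_nonneg fun A => M.JU_nonneg A

/-- By translation invariance the terms of `J⁰` at any site sum to at most `‖J⁰‖`. -/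
lemma sum_JU_le_normJU (x : Λ) :
    ∑ B : Finset Λ with x ∈ B, M.JU (toLattice B) ≤ M.normJU := by
  have hsum : Summable fun A : {A : Finset (Site d) // (0 : Site d) ∈ A} => M.JU A := by
    simpa only [abs_of_nonneg (M.JU_nonneg _)] using M.JU_shortRange
  set g : {B : Finset Λ // x ∈ B} → {A : Finset (Site d) // (0 : Site d) ∈ A} := fun B =>
    ⟨(toLattice B.1).image fun y => y + -(x : Site d), by
      rw [Finset.mem_image]
      exact ⟨x, Finset.mem_map.2 ⟨x, B.2, rfl⟩, by simp⟩⟩ with hg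
  have hinj : Function.Injective g := by
    intro B B' h
    have h1 := congrArg Subtype.val h
    have h2 : toLattice B.1 = toLattice B'.1 :=
      Finset.image_injective (add_left_injective (-(x : Site d))) h1
    exact Subtype.ext (Finset.map_injective _ h2)
  have h1 : ∑ B : Finset Λ with x ∈ B, M.JU (toLattice B) =
      ∑ B : {B : Finset Λ // x ∈ B}, M.JU (g B) := by
    simp only [hg, M.JU_translation]
    exact (Finset.sum_subtype _ (by simp) _)
  have h2 : ∑ B, M.JU (g B) = ∑ A ∈ Finset.univ.map ⟨g, hinj⟩, M.JU A :=
    (Finset.sum_map Finset.univ ⟨g, hinj⟩ fun A => M.JU A).symm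
  rw [h1, h2]
  exact hsum.sum_le_tsum _ fun A _ => M.JU_nonneg A

/-- Reversing two spins changes `U⁰` by at most `4 α ‖J⁰‖`: only the terms that contain one of
the two sites change, each by at most twice its coefficient. -/
lemma U0_flip_pair_sub_le (x y : Λ) (s : SpinConfig Λ) :
    M.U0 Λ (flipSpins {x, y} s) - M.U0 Λ s ≤ M.α * (4 * M.normJU) := by
  have h1 : M.U0 Λ (flipSpins {x, y} s) - M.U0 Λ s =
      M.α * ∑ B : Finset Λ, M.JU (toLattice B) *
        (spinProd B s - spinProd B (flipSpins {x, y} s)) := by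
    simp only [U0, mul_sub, Finset.sum_sub_distrib]
    ring
  rw [h1]
  refine mul_le_mul_of_nonneg_left ?_ M.α_nonneg
  have h2 : ∀ B : Finset Λ, M.JU (toLattice B) *
      (spinProd B s - spinProd B (flipSpins {x, y} s)) ≤
      (if x ∈ B then 2 * M.JU (toLattice B) else 0) +
        if y ∈ B then 2 * M.JU (toLattice B) else 0 := by
    intro B
    have hJ := M.JU_nonneg (toLattice B)
    have h3 : spinProd B s - spinProd B (flipSpins {x, y} s) ≤ 2 := by
      have e1 := le_abs_self (spinProd B s)
      have e2 := neg_abs_le (spinProd B (flipSpins {x, y} s))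
      rw [abs_spinProd] at e1 e2
      linarith
    have h4 := mul_le_mul_of_nonneg_left h3 hJ
    by_cases hx : x ∈ B
    · rw [if_pos hx]
      split_ifs <;> linarith
    · by_cases hy : y ∈ B
      · rw [if_neg hx, if_pos hy]
        linarith
      · rw [if_neg hx, if_neg hy, spinProd_flipSpins_of_disjoint (by simp [hx, hy])]
        simp
  refine (Finset.sum_le_sum fun B _ => h2 B).trans ?_
  rw [Finset.sum_add_distrib, ← Finset.sum_filter, ← Finset.sum_filter, ← Finset.mul_sum,
    ← Finset.mul_sum]
  linarith [M.sum_JU_le_normJU Λ x, M.sum_JU_le_normJU Λ y]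

/-- The bound behind the order in `S¹`. It rests on
`((a + b) / 2)² - a² = (b - a) (b + 3 a) / 4` and `|b + 3 a| ≤ |b + a| + 2 |a|` for
`a = φ_x(s)` and `b = φ_x(s^A)`. -/
lemma le_overlap_flip_pair {C B₁ B₂ : ℝ} {x y : Λ} {s : SpinConfig Λ}
    (hC : ∀ z, |M.φ Λ z s| ≤ C) (h₁ : M.W Λ 1 {x, y} s ≤ B₁) (h₂ : M.W Λ 2 {x, y} s ≤ B₂) :
    Real.exp (-(M.η ^ 2 * M.μ / 4) * (B₂ + 2 * C * B₁) - M.α / 2 * (4 * M.normJU)) *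
      Real.exp (M.spinInteraction Λ s) ≤ M.overlap Λ s (flipSpins {x, y} s) := by
  rw [overlap, ← Real.exp_sum, ← Real.exp_add, ← Real.exp_add, Real.exp_le_exp]
  have hμ := M.μ_pos
  rcases isEmpty_or_nonempty Λ with hΛ | ⟨⟨z₀⟩⟩
  · exact hΛ.elim x
  have hC0 : 0 ≤ C := (abs_nonneg _).trans (hC z₀)
  have hU := M.U0_flip_pair_sub_le Λ x y s
  have h3 : ∀ z, M.φ Λ z s ^ 2 -
      1 / 4 * (|M.φ Λ z (flipSpins {x, y} s) ^ 2 - M.φ Λ z s ^ 2| +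
        2 * C * |M.φ Λ z (flipSpins {x, y} s) ^ 1 - M.φ Λ z s ^ 1|) ≤
      ((M.φ Λ z s + M.φ Λ z (flipSpins {x, y} s)) / 2) ^ 2 := by
    intro z
    have ha := hC z
    generalize M.φ Λ z s = a at *
    generalize M.φ Λ z (flipSpins {x, y} s) = b at *
    have e1 : |b ^ 2 - a ^ 2| = |b - a| * |b + a| := by rw [← abs_mul]; congr 1; ring
    have e2 : |b + 3 * a| ≤ |b + a| + 2 * C := by
      calc |b + 3 * a| = |(b + a) + 2 * a| := by congr 1; ring
        _ ≤ |b + a| + |2 * a| := abs_add_le _ _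
        _ ≤ |b + a| + 2 * C := by rw [abs_mul, abs_two]; linarith
    have e3 : -(|b - a| * |b + 3 * a|) ≤ (b - a) * (b + 3 * a) := by
      rw [← abs_mul]; exact neg_abs_le _
    have e4 := mul_le_mul_of_nonneg_left e2 (abs_nonneg (b - a))
    rw [e1, pow_one, pow_one]
    nlinarith
  have h4 := Finset.sum_le_sum fun z (_ : z ∈ (Finset.univ : Finset Λ)) => h3 z
  rw [Finset.sum_sub_distrib, ← Finset.mul_sum, Finset.sum_add_distrib, ← Finset.mul_sum] at h4
  have h5 : ∑ z, M.φ Λ z s ^ 2 - 1 / 4 * (B₂ + 2 * C * B₁) ≤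
      ∑ z, ((M.φ Λ z s + M.φ Λ z (flipSpins {x, y} s)) / 2) ^ 2 := by
    have h₁' := mul_le_mul_of_nonneg_left h₁ (by positivity : 0 ≤ 2 * C)
    unfold W at h₂ h₁'
    linarith
  have h6 := mul_le_mul_of_nonneg_left h5 (by positivity : 0 ≤ M.μ * M.η ^ 2)
  have h7 : ∑ z, M.μ * M.meanShift Λ s (flipSpins {x, y} s) z ^ 2 =
      M.μ * M.η ^ 2 * ∑ z, ((M.φ Λ z s + M.φ Λ z (flipSpins {x, y} s)) / 2) ^ 2 := by
    rw [Finset.mul_sum]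
    exact Finset.sum_congr rfl fun z _ => by rw [meanShift]; ring
  rw [h7, spinInteraction]
  linarith

theorem le_average_opS1_opS1 {C B₁ B₂ : ℝ} (hC0 : 0 ≤ C) (hB₁ : 0 ≤ B₁) (hB₂ : 0 ≤ B₂)
    (hC : ∀ z s, |M.φ Λ z s| ≤ C)
    (hW : ∀ A : Finset Λ, A.card = 2 → ∀ s, M.W Λ 1 A s ≤ B₁ ∧ M.W Λ 2 A s ≤ B₂) (x y : Λ) :
    Real.exp (-(M.η ^ 2 * M.μ / 4) * (B₂ + 2 * C * B₁) - M.α / 2 * (4 * M.normJU)) ≤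
      (M.average Λ fun F => opS1 x (opS1 y F)).re := by
  by_cases hxy : x = y
  · subst hxy
    have h1 : (M.average Λ fun F => opS1 x (opS1 x F)).re = 1 := by
      rw [M.average_re Λ (M.ΨR Λ)]
      · simp only [integral_ΨR_mul, overlap_self]
        exact div_self (M.partition_pos Λ).ne'
      · intro q s
        simp only [opS1, opS1Prod, flipSpins_flipSpins, Ψ_eq]
    rw [h1, Real.exp_le_one_iff]
    have := M.μ_pos
    have := M.α_nonneg
    have := M.normJU_nonneg
    have e1 : 0 ≤ M.η ^ 2 * M.μ / 4 * (B₂ + 2 * C * B₁) := by positivity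
    have e2 : 0 ≤ M.α / 2 * (4 * M.normJU) := by positivity
    linarith
  · have h1 : (fun F : WaveFn Λ => opS1 x (opS1 y F)) = opS1Prod {x, y} := by
      funext F q s
      simp only [opS1, opS1Prod, flipSpins_singleton_singleton hxy]
    rw [h1, average_opS1Prod, le_div_iff₀ (M.partition_pos Λ), partition, Finset.mul_sum]
    refine Finset.sum_le_sum fun s _ => ?_
    have h2 := hW {x, y} (Finset.card_pair hxy) s
    exact M.le_overlap_flip_pair Λ (fun z => hC z s) h2.1 h2.2

end SpinOscModel

/-! ### Order in `S³` and in the oscillator variables -/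

section Comparison

variable {d : ℕ} {Λ : Finset (Site d)}

/-- From a combination of ferromagnetic functions one may take away a fraction of some of its
terms. -/
lemma Ferromagnetic.sum_sub {κ E : Type*} [Fintype κ] {T : Finset E} {g : E → κ}
    (hg : Set.InjOn g T) {k : κ → ℝ} (hk : ∀ i, 0 ≤ k i) {b : κ → SpinConfig Λ → ℝ}
    (hb : ∀ i, Ferromagnetic (b i)) {J : ℝ} (hJ : ∀ e ∈ T, J ≤ k (g e)) :
    Ferromagnetic fun s => ∑ i, k i * b i s - J * ∑ e ∈ T, b (g e) s := by
  classical
  have h : (fun s => ∑ i, k i * b i s - J * ∑ e ∈ T, b (g e) s) =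
      fun s => ∑ i, (k i - if i ∈ T.image g then J else 0) * b i s := by
    funext s
    rw [← Finset.sum_image (f := fun i => b i s) hg, Finset.mul_sum]
    simp only [sub_mul, Finset.sum_sub_distrib, ite_mul, zero_mul]
    rw [← Finset.sum_filter, Finset.filter_mem_eq_inter, Finset.univ_inter]
  rw [h]
  refine Ferromagnetic.sum _ fun i _ => (hb i).const_mul ?_
  split_ifs with hi
  · obtain ⟨e, he, rfl⟩ := Finset.mem_image.1 hi
    exact sub_nonneg.2 (hJ e he)
  · rw [sub_zero]
    exact hk i

lemma toLattice_singleton (x : Λ) : toLattice {x} = {(x : Site d)} := Finset.map_singleton _ _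

lemma toLattice_pair (x y : Λ) : toLattice {x, y} = {(x : Site d), (y : Site d)} := by
  simp [toLattice, Finset.map_insert]

/-- A copy of the grid `{0, …, L - 1}²` in `Λ`, with its edges between nearest neighbours. -/
structure IsGridIn (L : ℕ) (f : ℕ → ℕ → Λ) : Prop where
  inj : ∀ i j i' j', i < L → j < L → i' < L → j' < L → f i j = f i' j' → i = i' ∧ j = j'
  nn : ∀ e ∈ gridEdges L, NearestNeighbors (f e.1 e.2.1 : Site d)
    (f (gridTgt e).1 (gridTgt e).2 : Site d)

lemma gridEdge_ext {e e' : GridEdge} (h1 : e.1 = e'.1) (h2 : e.2.1 = e'.2.1)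
    (h3 : gridTgt e = gridTgt e') : e = e' := by
  obtain ⟨i, j, b⟩ := e
  obtain ⟨i', j', b'⟩ := e'
  obtain rfl : i = i' := h1
  obtain rfl : j = j' := h2
  cases b <;> cases b' <;> simp_all [gridTgt]

lemma gridTgt_sum (e : GridEdge) : (gridTgt e).1 + (gridTgt e).2 = e.1 + e.2.1 + 1 := by
  obtain ⟨i, j, b⟩ := e
  cases b <;> simp only [gridTgt, cond_true, cond_false] <;> omega

variable {L : ℕ} {f : ℕ → ℕ → Λ}

lemma IsGridIn.injOn (hf : IsGridIn L f) {e e' : GridEdge} (he : e ∈ gridEdges L)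
    (he' : e' ∈ gridEdges L) (h1 : f e.1 e.2.1 = f e'.1 e'.2.1)
    (h2 : f (gridTgt e).1 (gridTgt e).2 = f (gridTgt e').1 (gridTgt e').2) : e = e' := by
  obtain ⟨⟨a1, a2⟩, a3, a4⟩ := mem_gridEdges.1 he
  obtain ⟨⟨b1, b2⟩, b3, b4⟩ := mem_gridEdges.1 he'
  obtain ⟨c1, c2⟩ := hf.inj _ _ _ _ a1 a2 b1 b2 h1
  obtain ⟨c3, c4⟩ := hf.inj _ _ _ _ a3 a4 b3 b4 h2
  exact gridEdge_ext c1 c2 (Prod.ext c3 c4)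

lemma IsGridIn.src_ne_tgt (hf : IsGridIn L f) {e e' : GridEdge} (he : e ∈ gridEdges L)
    (he' : e' ∈ gridEdges L) (h1 : f e.1 e.2.1 = f (gridTgt e').1 (gridTgt e').2) :
    f (gridTgt e).1 (gridTgt e).2 ≠ f e'.1 e'.2.1 := by
  intro h2
  obtain ⟨⟨a1, a2⟩, a3, a4⟩ := mem_gridEdges.1 he
  obtain ⟨⟨b1, b2⟩, b3, b4⟩ := mem_gridEdges.1 he'
  obtain ⟨c1, c2⟩ := hf.inj _ _ _ _ a1 a2 b3 b4 h1
  obtain ⟨c3, c4⟩ := hf.inj _ _ _ _ a3 a4 b1 b2 h2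
  have := gridTgt_sum e
  have := gridTgt_sum e'
  omega

lemma gridInteraction_eq (s : SpinConfig Λ) : gridInteraction L f s = ∑ e ∈ gridEdges L,
    spinProd {f e.1 e.2.1} s * spinProd {f (gridTgt e).1 (gridTgt e).2} s := by
  refine Finset.sum_congr rfl fun e _ => ?_
  simp only [grad, spinProd_singleton]
  push_cast
  rfl

lemma ferromagnetic_gridInteraction : Ferromagnetic (gridInteraction L f) := by
  have : gridInteraction L f = fun s => ∑ e ∈ gridEdges L,
    spinProd {f e.1 e.2.1} s * spinProd {f (gridTgt e).1 (gridTgt e).2} s :=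
    funext gridInteraction_eq
  rw [this]
  exact Ferromagnetic.sum _ fun e _ => (Ferromagnetic.monomial _).mul (Ferromagnetic.monomial _)

end Comparison

namespace SpinOscModel

variable {d : ℕ} (M : SpinOscModel d) {Λ : Finset (Site d)}

/-- The effective spin interaction dominates the nearest-neighbour interaction of strength
`(η² μ + α) J̄` on any planar grid. In `φ_x²` only the terms `J₀(x;{x}) J₀(x;{y}) s_x s_y` are
used, with `y` the second endpoint of a grid edge that starts at `x`. -/
lemma ferromagnetic_spinInteraction_sub (hJ₀ : ∀ x A, 0 ≤ M.J₀ x A) {Jbar : ℝ}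
    (hJ : ∀ x y : Site d, NearestNeighbors x y → Jbar ≤ M.J₀ x {y} ∧ Jbar ≤ M.JU {x, y})
    {L : ℕ} {f : ℕ → ℕ → Λ} (hf : IsGridIn L f) :
    Ferromagnetic fun s => M.spinInteraction Λ s -
      (M.η ^ 2 * M.μ + M.α) * Jbar * gridInteraction L f s := by
  have hμ := M.μ_pos
  have hne : ∀ e ∈ gridEdges L, f e.1 e.2.1 ≠ f (gridTgt e).1 (gridTgt e).2 :=
    fun e he h => hf.src_ne_tgt he he h h.symm
  have h1 : Ferromagnetic fun s : SpinConfig Λ =>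
      ∑ i : Λ × Finset Λ × Finset Λ,
        M.J₀ i.1 (toLattice i.2.1) * M.J₀ i.1 (toLattice i.2.2) *
          (spinProd i.2.1 s * spinProd i.2.2 s) -
      Jbar * ∑ e ∈ gridEdges L,
        spinProd {f e.1 e.2.1} s * spinProd {f (gridTgt e).1 (gridTgt e).2} s := by
    refine Ferromagnetic.sum_sub (T := gridEdges L)
      (g := fun e => (f e.1 e.2.1, {f e.1 e.2.1}, {f (gridTgt e).1 (gridTgt e).2}))
      (k := fun i => M.J₀ i.1 (toLattice i.2.1) * M.J₀ i.1 (toLattice i.2.2))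
      (b := fun i s => spinProd i.2.1 s * spinProd i.2.2 s) ?_ ?_ ?_ ?_
    · intro e he e' he' h
      simp only [Prod.mk.injEq, Finset.singleton_inj] at h
      exact hf.injOn he he' h.1 h.2.2
    · exact fun i => mul_nonneg (hJ₀ _ _) (hJ₀ _ _)
    · exact fun i => (Ferromagnetic.monomial _).mul (Ferromagnetic.monomial _)
    · intro e he
      simp only [toLattice_singleton, M.J₀_self, one_mul]
      exact (hJ _ _ (hf.nn e he)).1
  have h2 : Ferromagnetic fun s : SpinConfig Λ =>
      ∑ A : Finset Λ, M.JU (toLattice A) * spinProd A s -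
      Jbar * ∑ e ∈ gridEdges L, spinProd {f e.1 e.2.1, f (gridTgt e).1 (gridTgt e).2} s := by
    refine Ferromagnetic.sum_sub (T := gridEdges L)
      (g := fun e => {f e.1 e.2.1, f (gridTgt e).1 (gridTgt e).2})
      (k := fun A => M.JU (toLattice A)) (b := fun A s => spinProd A s) ?_ ?_ ?_ ?_
    · intro e he e' he' h
      simp only at h
      have m1 : f e.1 e.2.1 ∈ ({f e'.1 e'.2.1, f (gridTgt e').1 (gridTgt e').2} : Finset Λ) := by
        rw [← h]; simp
      have m2 : f (gridTgt e).1 (gridTgt e).2 ∈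
          ({f e'.1 e'.2.1, f (gridTgt e').1 (gridTgt e').2} : Finset Λ) := by
        rw [← h]; simp
      rw [Finset.mem_insert, Finset.mem_singleton] at m1 m2
      rcases m1 with m1 | m1 <;> rcases m2 with m2 | m2
      · exact absurd (m1.trans m2.symm) (hne e he)
      · exact hf.injOn he he' m1 m2
      · exact absurd m2 (hf.src_ne_tgt he he' m1)
      · exact absurd (m1.trans m2.symm) (hne e he)
    · exact fun A => M.JU_nonneg _
    · exact fun A => Ferromagnetic.monomial A
    · intro e he
      rw [toLattice_pair]
      exact (hJ _ _ (hf.nn e he)).2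
  have h3 := (h1.const_mul (by positivity : 0 ≤ M.η ^ 2 * M.μ)).add (h2.const_mul M.α_nonneg)
  convert h3 using 2 with s
  have e1 : ∑ e ∈ gridEdges L, spinProd {f e.1 e.2.1, f (gridTgt e).1 (gridTgt e).2} s =
      gridInteraction L f s := by
    rw [gridInteraction_eq]
    refine Finset.sum_congr rfl fun e he => ?_
    rw [spinProd_pair (hne e he), spinProd_singleton, spinProd_singleton]
  have e2 : ∑ x, M.φ Λ x s ^ 2 = ∑ i : Λ × Finset Λ × Finset Λ,
        M.J₀ i.1 (toLattice i.2.1) * M.J₀ i.1 (toLattice i.2.2) *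
          (spinProd i.2.1 s * spinProd i.2.2 s) := by
    rw [Fintype.sum_prod_type]
    refine Finset.sum_congr rfl fun x _ => ?_
    rw [φ, sq, Finset.sum_mul_sum, Fintype.sum_prod_type]
    exact Finset.sum_congr rfl fun A _ => Finset.sum_congr rfl fun B _ => by ring
  rw [e1, ← gridInteraction_eq, ← e2, spinInteraction, U0]
  ring

/-- `∑_s (1 - s_x s_y) exp (spinInteraction s)`, twice the unnormalised probability that the
spins at `x` and `y` differ. -/
def disagreement (x y : Λ) : ℝ :=
  ∑ s : SpinConfig Λ, (1 - ((s x : ℤ) : ℝ) * ((s y : ℤ) : ℝ)) * Real.exp (M.spinInteraction Λ s)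

lemma disagreement_self (x : Λ) : M.disagreement x x = 0 := by
  simp [disagreement, unit_mul_self_real]

lemma disagreement_triangle (x y z : Λ) :
    M.disagreement x z ≤ M.disagreement x y + M.disagreement y z := by
  rw [disagreement, disagreement, disagreement, ← Finset.sum_add_distrib]
  refine Finset.sum_le_sum fun s _ => ?_
  rw [← add_mul]
  refine mul_le_mul_of_nonneg_right ?_ (Real.exp_pos _).le
  rcases Int.units_eq_one_or (s x) with h1 | h1 <;> rcases Int.units_eq_one_or (s y) with h2 | h2 <;>
    rcases Int.units_eq_one_or (s z) with h3 | h3 <;> rw [h1, h2, h3] <;> norm_num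

/-- Two sites of a row of a planar grid in `Λ`: Griffiths' inequality reduces the correlation to
the Ising model on the grid, to which the Peierls bound applies. -/
lemma disagreement_le_of_grid (hJ₀ : ∀ x A, 0 ≤ M.J₀ x A) {Jbar : ℝ}
    (hJ : ∀ x y : Site d, NearestNeighbors x y → Jbar ≤ M.J₀ x {y} ∧ Jbar ≤ M.JU {x, y})
    {β : ℝ} (hβ : β = (M.η ^ 2 * M.μ + M.α) * Jbar) (hβ0 : 0 ≤ β)
    (hβ1 : 128 * Real.exp (-(2 * β)) ≤ 1 / 2)
    {L : ℕ} {f : ℕ → ℕ → Λ} (hf : IsGridIn L f) {r k k' : ℕ}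
    (hr : r < L) (hk : k < L) (hk' : k' < L) :
    M.disagreement (f k r) (f k' r) ≤ 3072 * Real.exp (-(2 * β)) * M.partition Λ := by
  by_cases hxy : f k r = f k' r
  · rw [hxy, disagreement_self]
    have := (M.partition_pos Λ).le
    positivity
  have h1 := Ferromagnetic.correlation_mono (M.ferromagnetic_spinInteraction_sub hJ₀ hJ hf)
    ((ferromagnetic_gridInteraction (L := L) (f := f)).const_mul (hβ ▸ hβ0)) {f k r, f k' r}
  simp only [sub_add_cancel, spinProd_pair hxy, ← hβ] at h1
  have h2 := peierls_bound hf.inj hr hk hk' hβ1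
  set Z := ∑ s : SpinConfig Λ, Real.exp (β * gridInteraction L f s) with hZ
  have hZ0 : 0 < Z := Finset.sum_pos (fun _ _ => Real.exp_pos _) Finset.univ_nonempty
  have h3 : ∑ s : SpinConfig Λ, ((s (f k r) : ℤ) : ℝ) * ((s (f k' r) : ℤ) : ℝ) *
      Real.exp (β * gridInteraction L f s) = Z - 2 * ∑ s : SpinConfig Λ,
        (if s (f k r) ≠ s (f k' r) then Real.exp (β * gridInteraction L f s) else 0) := by
    rw [hZ, Finset.mul_sum, ← Finset.sum_sub_distrib]
    refine Finset.sum_congr rfl fun s _ => ?_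
    rcases Int.units_eq_one_or (s (f k r)) with h1 | h1 <;>
      rcases Int.units_eq_one_or (s (f k' r)) with h2 | h2 <;> rw [h1, h2]
    · simp
    · rw [if_pos (by decide)]; simp; ring
    · rw [if_pos (by decide)]; simp; ring
    · simp
  have h4 : M.disagreement (f k r) (f k' r) = M.partition Λ - ∑ s : SpinConfig Λ,
      ((s (f k r) : ℤ) : ℝ) * ((s (f k' r) : ℤ) : ℝ) * Real.exp (M.spinInteraction Λ s) := by
    simp only [disagreement, partition, sub_mul, one_mul, Finset.sum_sub_distrib]
  have hP := M.partition_pos Λ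
  rw [h3] at h1
  change _ * M.partition Λ ≤ _ at h1
  have h5 : (1 - 3072 * Real.exp (-(2 * β))) * Z ≤ Z - 2 * ∑ s : SpinConfig Λ,
        (if s (f k r) ≠ s (f k' r) then Real.exp (β * gridInteraction L f s) else 0) := by
    linarith
  have h6 := (mul_le_mul_of_nonneg_right h5 hP.le).trans h1
  have h7 : (1 - 3072 * Real.exp (-(2 * β))) * M.partition Λ ≤ ∑ s : SpinConfig Λ,
      ((s (f k r) : ℤ) : ℝ) * ((s (f k' r) : ℤ) : ℝ) * Real.exp (M.spinInteraction Λ s) := by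
    refine le_of_mul_le_mul_right ?_ hZ0
    linarith
  rw [h4]
  linarith

end SpinOscModel

/-- Two sites of a hyper-cube that differ in one coordinate lie in a row of a planar grid of the
hyper-cube. -/
lemma exists_grid {d : ℕ} (hd : 2 ≤ d) {Λ : Finset (Site d)} (hΛ : IsHypercube Λ) (x y : Λ)
    (i : Fin d) (hxy : ∀ j, j ≠ i → (x : Site d) j = (y : Site d) j) :
    ∃ (L : ℕ) (f : ℕ → ℕ → Λ) (r k k' : ℕ), IsGridIn L f ∧ r < L ∧ k < L ∧ k' < L ∧
      f k r = x ∧ f k' r = y := by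
  obtain ⟨c, L, rfl⟩ := hΛ
  have hmem : ∀ z : Site d, z ∈ (Fintype.piFinset fun i => Finset.Ico (c i) (c i + (L : ℤ))) ↔
      ∀ l, c l ≤ z l ∧ z l < c l + L := by
    intro z
    simp only [Fintype.mem_piFinset, Finset.mem_Ico]
  obtain ⟨j, hj⟩ : ∃ j : Fin d, j ≠ i := by
    have : Nontrivial (Fin d) := Fin.nontrivial_iff_two_le.2 hd
    exact exists_ne i
  have hx := (hmem _).1 x.2
  have hy := (hmem _).1 y.2
  set p : ℕ → ℕ → Site d := fun m n =>
    Function.update (Function.update (x : Site d) i (c i + m)) j (c j + n) with hp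
  have hpi : ∀ m n, p m n i = c i + m := fun m n => by simp [hp, Function.update_of_ne hj.symm]
  have hpj : ∀ m n, p m n j = c j + n := fun m n => by simp [hp]
  have hpl : ∀ m n l, l ≠ i → l ≠ j → p m n l = (x : Site d) l := fun m n l h1 h2 => by
    simp [hp, h1, h2]
  have hpm : ∀ m n, m < L → n < L →
      p m n ∈ (Fintype.piFinset fun i => Finset.Ico (c i) (c i + (L : ℤ))) := by
    intro m n hm hn
    rw [hmem]
    intro l
    by_cases h1 : l = i
    · subst h1; rw [hpi]; omega
    · by_cases h2 : l = j
      · subst h2; rw [hpj]; omega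
      · rw [hpl m n l h1 h2]; exact hx l
  set f : ℕ → ℕ → (Fintype.piFinset fun i => Finset.Ico (c i) (c i + (L : ℤ)) : Finset (Site d)) :=
    fun m n => if h : m < L ∧ n < L then ⟨p m n, hpm m n h.1 h.2⟩ else x with hf
  have hfp : ∀ m n, m < L → n < L → (f m n : Site d) = p m n := fun m n hm hn => by
    simp only [hf, dif_pos (And.intro hm hn)]
  have hxi := hx i
  have hxj := hx j
  have hyi := hy i
  refine ⟨L, f, ((x : Site d) j - c j).toNat, ((x : Site d) i - c i).toNat,
    ((y : Site d) i - c i).toNat, ⟨?_, ?_⟩, by omega, by omega, by omega, ?_, ?_⟩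
  · intro m n m' n' hm hn hm' hn' h
    have h1 : p m n = p m' n' := by rw [← hfp m n hm hn, ← hfp m' n' hm' hn', h]
    have h2 := congrFun h1 i
    have h3 := congrFun h1 j
    rw [hpi, hpi] at h2
    rw [hpj, hpj] at h3
    omega
  · intro e he
    obtain ⟨⟨a1, a2⟩, a3, a4⟩ := mem_gridEdges.1 he
    rw [hfp _ _ a1 a2, hfp _ _ a3 a4]
    obtain ⟨m, n, b⟩ := e
    unfold NearestNeighbors
    cases b
    · rw [Finset.sum_eq_single i]
      · simp only [gridTgt, cond_false, hpi]
        push_cast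
        rw [add_sub_add_left_eq_sub, sub_add_cancel_left, abs_neg, abs_one]
      · intro l _ hl
        by_cases h2 : l = j
        · subst h2; simp [hpj, gridTgt]
        · rw [hpl _ _ l hl h2, hpl _ _ l hl h2]; simp
      · intro h; exact absurd (Finset.mem_univ _) h
    · rw [Finset.sum_eq_single j]
      · simp only [gridTgt, cond_true, hpj]
        push_cast
        rw [add_sub_add_left_eq_sub, sub_add_cancel_left, abs_neg, abs_one]
      · intro l _ hl
        by_cases h2 : l = i
        · subst h2; simp [hpi, gridTgt]
        · rw [hpl _ _ l h2 hl, hpl _ _ l h2 hl]; simp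
      · intro h; exact absurd (Finset.mem_univ _) h
  · apply Subtype.ext
    rw [hfp _ _ (by omega) (by omega)]
    funext l
    by_cases h1 : l = i
    · subst h1; rw [hpi]; omega
    · by_cases h2 : l = j
      · subst h2; rw [hpj]; omega
      · rw [hpl _ _ l h1 h2]
  · apply Subtype.ext
    rw [hfp _ _ (by omega) (by omega)]
    funext l
    by_cases h1 : l = i
    · subst h1; rw [hpi]; omega
    · by_cases h2 : l = j
      · subst h2; rw [hpj, ← hxy l h1]; omega
      · rw [hpl _ _ l h1 h2, hxy l h1]

namespace SpinOscModel

variable {d : ℕ} (M : SpinOscModel d) {Λ : Finset (Site d)}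

/-- Any two sites of a hyper-cube are joined by at most `d` moves in one coordinate each. -/
lemma disagreement_le (hd : 2 ≤ d) (hΛ : IsHypercube Λ) (hJ₀ : ∀ x A, 0 ≤ M.J₀ x A) {Jbar : ℝ}
    (hJ : ∀ x y : Site d, NearestNeighbors x y → Jbar ≤ M.J₀ x {y} ∧ Jbar ≤ M.JU {x, y})
    {β : ℝ} (hβ : β = (M.η ^ 2 * M.μ + M.α) * Jbar) (hβ0 : 0 ≤ β)
    (hβ1 : 128 * Real.exp (-(2 * β)) ≤ 1 / 2) (x y : Λ) :
    M.disagreement x y ≤ d * (3072 * Real.exp (-(2 * β)) * M.partition Λ) := by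
  have hmem : ∀ T : Finset (Fin d),
      (fun i => if i ∈ T then (y : Site d) i else (x : Site d) i) ∈ Λ := by
    obtain ⟨c, L, rfl⟩ := hΛ
    intro T
    have hx := Fintype.mem_piFinset.1 x.2
    have hy := Fintype.mem_piFinset.1 y.2
    refine Fintype.mem_piFinset.2 fun i => ?_
    split_ifs
    · exact hy i
    · exact hx i
  have key : ∀ T : Finset (Fin d), M.disagreement x ⟨_, hmem T⟩ ≤
      T.card * (3072 * Real.exp (-(2 * β)) * M.partition Λ) := by
    intro T
    induction T using Finset.induction_on with
    | empty =>
      have : (⟨_, hmem ∅⟩ : Λ) = x := Subtype.ext (by funext i; simp)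
      rw [this, disagreement_self]
      simp
    | insert i T hi ih =>
      refine (M.disagreement_triangle x ⟨_, hmem T⟩ _).trans ?_
      obtain ⟨L, f, r, k, k', hf, hr, hk, hk', h1, h2⟩ := exists_grid hd hΛ ⟨_, hmem T⟩
        ⟨_, hmem (insert i T)⟩ i fun j hj => by simp [hj]
      have h3 := M.disagreement_le_of_grid hJ₀ hJ hβ hβ0 hβ1 hf hr hk hk'
      rw [h1, h2] at h3
      rw [Finset.card_insert_of_notMem hi]
      push_cast
      linarith
  have h := key Finset.univ
  have hy : (⟨_, hmem Finset.univ⟩ : Λ) = y := Subtype.ext (by funext i; simp)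
  rwa [hy, Finset.card_univ, Fintype.card_fin] at h

theorem half_le_average_opS3_opS3 (hd : 2 ≤ d) (hΛ : IsHypercube Λ) (hJ₀ : ∀ x A, 0 ≤ M.J₀ x A)
    {Jbar : ℝ}
    (hJ : ∀ x y : Site d, NearestNeighbors x y → Jbar ≤ M.J₀ x {y} ∧ Jbar ≤ M.JU {x, y})
    (hβ : 6144 * ((d : ℝ) + 1) ≤ (M.η ^ 2 * M.μ + M.α) * Jbar) (x y : Λ) :
    1 / 2 ≤ (M.average Λ fun F => opS3 x (opS3 y F)).re := by
  set β := (M.η ^ 2 * M.μ + M.α) * Jbar with hβdef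
  have hd0 : (0 : ℝ) ≤ d := Nat.cast_nonneg d
  have hβ0 : 0 ≤ β := by linarith
  have he : 6144 * ((d : ℝ) + 1) * Real.exp (-(2 * β)) ≤ 1 := by
    rw [Real.exp_neg, ← div_eq_mul_inv, div_le_one (Real.exp_pos _)]
    linarith [Real.add_one_le_exp (2 * β)]
  have he0 := Real.exp_pos (-(2 * β))
  have hβ1 : 128 * Real.exp (-(2 * β)) ≤ 1 / 2 := by
    nlinarith [mul_nonneg hd0 he0.le]
  have h := M.disagreement_le hd hΛ hJ₀ hJ hβdef hβ0 hβ1 x y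
  have hP := M.partition_pos Λ
  rw [average_opS3_opS3, le_div_iff₀ hP]
  have h4 : M.disagreement x y = M.partition Λ - ∑ s : SpinConfig Λ,
      ((s x : ℤ) : ℝ) * ((s y : ℤ) : ℝ) * Real.exp (M.spinInteraction Λ s) := by
    simp only [disagreement, partition, sub_mul, one_mul, Finset.sum_sub_distrib]
  have h5 : d * (3072 * Real.exp (-(2 * β))) ≤ 1 / 2 := by nlinarith
  have h6 := mul_le_mul_of_nonneg_right h5 hP.le
  linarith

lemma ferromagnetic_φ (hJ₀ : ∀ x A, 0 ≤ M.J₀ x A) (x : Λ) : Ferromagnetic (M.φ Λ x) :=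
  ⟨fun A => M.J₀ x (toLattice A), fun _ => hJ₀ _ _, fun _ => rfl⟩

lemma ferromagnetic_φ_sub (hJ₀ : ∀ x A, 0 ≤ M.J₀ x A) (x : Λ) :
    Ferromagnetic fun s => M.φ Λ x s - ((s x : ℤ) : ℝ) := by
  have := Ferromagnetic.sum_sub (Λ := Λ) (T := {x}) (g := fun y : Λ => ({y} : Finset Λ))
    (Finset.singleton_injective.injOn) (k := fun A => M.J₀ x (toLattice A)) (fun _ => hJ₀ _ _)
    (b := fun A s => spinProd A s) (fun A => Ferromagnetic.monomial A) (J := 1) (by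
      intro e he
      rw [Finset.mem_singleton.1 he, toLattice_singleton, M.J₀_self])
  simp only [one_mul, Finset.sum_singleton, spinProd_singleton] at this
  exact this

lemma ferromagnetic_spinInteraction (hJ₀ : ∀ x A, 0 ≤ M.J₀ x A) :
    Ferromagnetic (M.spinInteraction Λ) := by
  have hμ := M.μ_pos
  have h1 := (Ferromagnetic.sum Finset.univ fun x (_ : x ∈ (Finset.univ : Finset Λ)) =>
    (M.ferromagnetic_φ hJ₀ x).mul (M.ferromagnetic_φ hJ₀ x)).const_mul
    (by positivity : 0 ≤ M.μ * M.η ^ 2)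
  have h2 : Ferromagnetic fun s : SpinConfig Λ =>
      ∑ A : Finset Λ, M.JU (toLattice A) * spinProd A s :=
    ⟨_, fun A => M.JU_nonneg _, fun _ => rfl⟩
  convert h1.add (h2.const_mul M.α_nonneg) using 2 with s
  simp only [spinInteraction, U0, sq (M.φ Λ _ s)]
  ring

/-- `φ_x φ_y` has the correlation `s_x s_y` as one of its non-negative terms, so Griffiths' first
inequality gives order in the oscillators from order in `S³`. -/
theorem le_average_opQ_opQ (hJ₀ : ∀ x A, 0 ≤ M.J₀ x A) (x y : Λ) :
    M.η ^ 2 * (M.average Λ fun F => opS3 x (opS3 y F)).re ≤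
      (M.average Λ fun F => opQ x (opQ y F)).re := by
  rw [average_opS3_opS3, average_opQ_opQ, ← mul_div_assoc]
  refine div_le_div_of_nonneg_right ?_ (M.partition_pos Λ).le
  have hμ := M.μ_pos
  have h1 : Ferromagnetic fun s => (M.φ Λ x s - ((s x : ℤ) : ℝ)) * M.φ Λ y s +
      ((s x : ℤ) : ℝ) * (M.φ Λ y s - ((s y : ℤ) : ℝ)) := by
    refine ((M.ferromagnetic_φ_sub hJ₀ x).mul (M.ferromagnetic_φ hJ₀ y)).add
      (Ferromagnetic.mul ?_ (M.ferromagnetic_φ_sub hJ₀ y))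
    simpa only [← spinProd_singleton] using Ferromagnetic.monomial {x}
  have h2 := Ferromagnetic.sum_nonneg (h1.mul (M.ferromagnetic_spinInteraction hJ₀).exp)
  have h3 := mul_nonneg (sq_nonneg M.η) h2
  rw [Finset.mul_sum] at h3
  rw [Finset.mul_sum, ← sub_nonneg, ← Finset.sum_sub_distrib]
  refine h3.trans (Finset.sum_le_sum fun s _ => ?_)
  have h4 : 0 ≤ (if x = y then 1 / (2 * M.μ) else 0) * Real.exp (M.spinInteraction Λ s) := by
    split_ifs <;> positivity
  linarith

end SpinOscModel

/-! ### The Gibbsian vector is a Schwartz function -/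

open scoped Nat in
/-- Polynomials are dominated by the inverse of a Gaussian. -/
lemma one_add_pow_mul_exp_neg_sq_le (m : ℕ) (K : ℝ) {ε : ℝ} (hε : 0 < ε) {t : ℝ} (ht : 0 ≤ t) :
    (1 + t) ^ m * Real.exp (K - ε * t ^ 2) ≤ m ! * Real.exp (1 + K + 1 / (4 * ε)) := by
  have h1 := Real.pow_div_factorial_le_exp (1 + t) (by positivity) m
  rw [div_le_iff₀ (by positivity)] at h1
  calc (1 + t) ^ m * Real.exp (K - ε * t ^ 2)
      ≤ Real.exp (1 + t) * m ! * Real.exp (K - ε * t ^ 2) :=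
        mul_le_mul_of_nonneg_right h1 (Real.exp_pos _).le
    _ = m ! * Real.exp (1 + t + (K - ε * t ^ 2)) := by rw [Real.exp_add (1 + t)]; ring
    _ ≤ m ! * Real.exp (1 + K + 1 / (4 * ε)) := by
        refine mul_le_mul_of_nonneg_left (Real.exp_le_exp.2 ?_) (by positivity)
        have h2 : t - ε * t ^ 2 = 1 / (4 * ε) - ε * (t - 1 / (2 * ε)) ^ 2 := by
          field_simp
          ring
        have h3 : 0 ≤ ε * (t - 1 / (2 * ε)) ^ 2 := by positivity
        linarith

open scoped ContDiff Nat in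
/-- The exponential of a function of temperate growth that is at most `K - ε ‖x‖²` is a Schwartz
function: its derivatives are bounded by the function itself times polynomials. -/
lemma exists_schwartz_exp {E : Type*} [NormedAddCommGroup E] [NormedSpace ℝ E] {h : E → ℝ}
    (hh : h.HasTemperateGrowth) {K ε : ℝ} (hε : 0 < ε) (hb : ∀ x, h x ≤ K - ε * ‖x‖ ^ 2) :
    ∃ f : 𝓢(E, ℝ), ∀ x, f x = Real.exp (h x) := by
  refine ⟨⟨fun x => Real.exp (h x), Real.contDiff_exp.comp hh.1, fun k n => ?_⟩, fun x => rfl⟩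
  obtain ⟨l, C, hC, hd⟩ := hh.norm_iteratedFDeriv_le_uniform n
  set C' := max C 1 with hC'
  have h1C' : 1 ≤ C' := le_max_right _ _
  refine ⟨n ! * C' ^ n * ((k + l * n)! * Real.exp (1 + K + 1 / (4 * ε))), fun x => ?_⟩
  have hx1 : 1 ≤ 1 + ‖x‖ := by linarith [norm_nonneg x]
  have hpow : 1 ≤ (1 + ‖x‖) ^ l := one_le_pow₀ hx1
  have h1 : ‖iteratedFDeriv ℝ n (Real.exp ∘ h) x‖ ≤
      n ! * Real.exp (h x) * (C' * (1 + ‖x‖) ^ l) ^ n := by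
    refine norm_iteratedFDeriv_comp_le (N := ∞) Real.contDiff_exp hh.1
      (by exact_mod_cast le_top) x (fun i _ => ?_) fun i hi hin => ?_
    · rw [norm_iteratedFDeriv_eq_norm_iteratedDeriv, iteratedDeriv_eq_iterate,
        Real.iter_deriv_exp, Real.norm_of_nonneg (Real.exp_pos _).le]
    · calc ‖iteratedFDeriv ℝ i h x‖ ≤ C * (1 + ‖x‖) ^ l := hd i hin x
        _ ≤ C' * (1 + ‖x‖) ^ l := by gcongr; exact le_max_left _ _
        _ ≤ (C' * (1 + ‖x‖) ^ l) ^ i :=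
          le_self_pow₀ (one_le_mul_of_one_le_of_one_le h1C' hpow) (by omega)
  calc ‖x‖ ^ k * ‖iteratedFDeriv ℝ n (fun x => Real.exp (h x)) x‖
      ≤ (1 + ‖x‖) ^ k * (n ! * Real.exp (h x) * (C' * (1 + ‖x‖) ^ l) ^ n) := by
        gcongr
        · linarith
        · exact h1
    _ = n ! * C' ^ n * ((1 + ‖x‖) ^ (k + l * n) * Real.exp (h x)) := by
        rw [mul_pow, ← pow_mul, pow_add]; ring
    _ ≤ n ! * C' ^ n * ((1 + ‖x‖) ^ (k + l * n) * Real.exp (K - ε * ‖x‖ ^ 2)) := by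
        gcongr
        exact hb x
    _ ≤ _ := by
        exact mul_le_mul_of_nonneg_left (one_add_pow_mul_exp_neg_sq_le _ K hε (norm_nonneg x))
          (by positivity)

lemma norm_sq_le_sum_sq {ι : Type*} [Fintype ι] (q : ι → ℝ) : ‖q‖ ^ 2 ≤ ∑ x, q x ^ 2 := by
  have h : ‖q‖ ≤ √(∑ x, q x ^ 2) := by
    refine (pi_norm_le_iff_of_nonneg (Real.sqrt_nonneg _)).2 fun x => ?_
    rw [Real.norm_eq_abs, ← Real.sqrt_sq_eq_abs]
    exact Real.sqrt_le_sqrt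
      (Finset.single_le_sum (f := fun x => q x ^ 2) (fun y _ => sq_nonneg _) (Finset.mem_univ x))
  calc ‖q‖ ^ 2 ≤ √(∑ x, q x ^ 2) ^ 2 := pow_le_pow_left₀ (norm_nonneg _) h 2
    _ = _ := Real.sq_sqrt (Finset.sum_nonneg fun x _ => sq_nonneg _)

lemma hasTemperateGrowth_coord {ι : Type*} [Fintype ι] (x : ι) :
    Function.HasTemperateGrowth fun q : ι → ℝ => q x :=
  (ContinuousLinearMap.proj (R := ℝ) (φ := fun _ : ι => ℝ) x).hasTemperateGrowth

namespace SpinOscModel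

variable {d : ℕ} (M : SpinOscModel d) (Λ : Finset (Site d))

/-- The normalisation `∏_x (μ/π)^{1/4}`. -/
def gaussNorm : ℝ := ∏ _x : Λ, (M.μ / Real.pi) ^ (1 / 4 : ℝ)

lemma gaussNorm_pos : 0 < M.gaussNorm Λ :=
  Finset.prod_pos fun _ _ => Real.rpow_pos_of_pos (div_pos M.μ_pos Real.pi_pos) _

/-- The exponent of the Gaussian `Ψ_Λ(·; s)`. -/
def gaussExponent (s : SpinConfig Λ) (q : OscConfig Λ) : ℝ :=
  -(1 / 2) * M.U0 Λ s - ∑ x, (M.μ * M.η * M.φ Λ x s * q x + M.μ / 2 * q x ^ 2)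

lemma ΨR_eq (q : OscConfig Λ) (s : SpinConfig Λ) :
    M.ΨR Λ q s = M.gaussNorm Λ * Real.exp (M.gaussExponent Λ s q) := by
  simp only [ΨR, ψ₀, Finset.prod_mul_distrib, gaussNorm]
  rw [mul_left_comm, ← Real.exp_sum, ← Real.exp_add]
  congr 2
  rw [gaussExponent, U, Finset.sum_add_distrib, Finset.mul_sum, mul_add, Finset.mul_sum]
  have e1 : ∑ x, -(M.μ / 2) * q x ^ 2 = -∑ x, M.μ / 2 * q x ^ 2 := by
    rw [← Finset.sum_neg_distrib]
    exact Finset.sum_congr rfl fun x _ => by ring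
  have e2 : ∑ x, -(1 / 2) * (2 * M.μ * M.η * (q x * M.φ Λ x s)) =
      -∑ x, M.μ * M.η * M.φ Λ x s * q x := by
    rw [← Finset.sum_neg_distrib]
    exact Finset.sum_congr rfl fun x _ => by ring
  rw [e1, e2]
  ring

lemma ΨR_pos (q : OscConfig Λ) (s : SpinConfig Λ) : 0 < M.ΨR Λ q s := by
  rw [ΨR_eq]
  exact mul_pos (M.gaussNorm_pos Λ) (Real.exp_pos _)

lemma hasTemperateGrowth_gaussExponent (s : SpinConfig Λ) :
    (M.gaussExponent Λ s).HasTemperateGrowth := by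
  unfold gaussExponent
  refine (Function.HasTemperateGrowth.const _).sub (Function.HasTemperateGrowth.sum fun x _ => ?_)
  exact ((Function.HasTemperateGrowth.const _).mul (hasTemperateGrowth_coord x)).add
    ((Function.HasTemperateGrowth.const _).mul ((hasTemperateGrowth_coord x).pow 2))

lemma gaussExponent_le (s : SpinConfig Λ) (q : OscConfig Λ) : M.gaussExponent Λ s q ≤
    (-(1 / 2) * M.U0 Λ s + ∑ x, M.μ * M.η ^ 2 * M.φ Λ x s ^ 2) - M.μ / 4 * ‖q‖ ^ 2 := by
  have hμ := M.μ_pos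
  have h1 := mul_le_mul_of_nonneg_left (norm_sq_le_sum_sq q) (by positivity : 0 ≤ M.μ / 4)
  have h2 : ∑ x, (M.μ / 4 * q x ^ 2 - M.μ * M.η ^ 2 * M.φ Λ x s ^ 2) ≤
      ∑ x, (M.μ * M.η * M.φ Λ x s * q x + M.μ / 2 * q x ^ 2) := by
    refine Finset.sum_le_sum fun x _ => ?_
    have : 0 ≤ M.μ / 4 * (q x + 2 * (M.η * M.φ Λ x s)) ^ 2 := by positivity
    linarith
  rw [Finset.sum_sub_distrib, ← Finset.mul_sum] at h2
  rw [gaussExponent]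
  linarith

lemma exists_schwartz_Ψ (s : SpinConfig Λ) :
    ∃ f : 𝓢(OscConfig Λ, ℂ), ∀ q, M.Ψ Λ q s = f q := by
  obtain ⟨g, hg⟩ := exists_schwartz_exp (M.hasTemperateGrowth_gaussExponent Λ s)
    (by have := M.μ_pos; positivity : 0 < M.μ / 4) (M.gaussExponent_le Λ s)
  refine ⟨(M.gaussNorm Λ : ℂ) • SchwartzMap.postcompCLM Complex.ofRealCLM g, fun q => ?_⟩
  simp [Ψ_eq, ΨR_eq, hg]

/-- `V_Λ` is chosen so that it cancels the spin-flip terms on `Ψ_Λ`. -/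
lemma V_mul_ΨR (q : OscConfig Λ) (s : SpinConfig Λ) :
    M.V Λ q s * M.ΨR Λ q s = -∑ A : Finset Λ, M.JS Λ A q * M.ΨR Λ q (flipSpins A s) := by
  rw [V, neg_mul, Finset.sum_mul]
  congr 1
  refine Finset.sum_congr rfl fun A _ => ?_
  rw [ΨR, ΨR, mul_assoc, ← mul_assoc (Real.exp _), ← Real.exp_add]
  congr 3
  ring

lemma V_mul_Ψ (q : OscConfig Λ) (s : SpinConfig Λ) : (M.V Λ q s : ℂ) * M.Ψ Λ q s =
    -∑ A : Finset Λ, (M.JS Λ A q : ℂ) * M.Ψ Λ q (flipSpins A s) := by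
  simp only [Ψ_eq]
  rw [← Complex.ofReal_mul, V_mul_ΨR]
  push_cast
  rfl

open MeasureTheory in
lemma Ψ_mem_domain : M.Ψ Λ ∈ M.domain Λ := by
  intro s
  refine ⟨M.exists_schwartz_Ψ Λ s, ?_⟩
  have h1 : ∀ A : Finset Λ,
      MemLp (fun q => (M.JS Λ A q : ℂ) * M.Ψ Λ q (flipSpins A s)) 2 volume := by
    intro A
    obtain ⟨f, hf⟩ := M.exists_schwartz_Ψ Λ (flipSpins A s)
    obtain ⟨K, hK⟩ := M.JS_bounded Λ A
    simp only [hf]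
    have hJ : AEStronglyMeasurable (fun q => (M.JS Λ A q : ℂ)) volume :=
      (Complex.measurable_ofReal.comp (M.JS_measurable Λ A)).aestronglyMeasurable
    refine (f.memLp 2 volume).of_le_mul (c := K) (hJ.mul f.continuous.aestronglyMeasurable)
      (Filter.Eventually.of_forall fun q => ?_)
    rw [norm_mul, Complex.norm_real, Real.norm_eq_abs]
    exact mul_le_mul_of_nonneg_right (hK q) (norm_nonneg _)
  have h2 : MemLp (fun q => ∑ A : Finset Λ, (M.JS Λ A q : ℂ) * M.Ψ Λ q (flipSpins A s)) 2
      volume := memLp_finsetSum _ fun A _ => h1 A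
  have h3 : ∀ q, (M.V Λ q s : ℂ) * M.Ψ Λ q s =
      -∑ A : Finset Λ, (M.JS Λ A q : ℂ) * M.Ψ Λ q (flipSpins A s) := fun q => M.V_mul_Ψ Λ q s
  simp only [h3]
  exact h2.neg

lemma Ψ_ne_zero : M.Ψ Λ ≠ 0 := by
  intro h
  have h1 := congrFun (congrFun h 0) 1
  exact (M.ΨR_pos Λ 0 1).ne' (Complex.ofReal_eq_zero.1 h1)

lemma opD2_Ψ (x : Λ) (q : OscConfig Λ) (s : SpinConfig Λ) : opD2 x (M.Ψ Λ) q s =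
    ((M.μ ^ 2 * (q x + M.η * M.φ Λ x s) ^ 2 - M.μ : ℝ) : ℂ) * M.Ψ Λ q s := by
  set b : ℝ := M.μ * M.η * M.φ Λ x s with hb
  set g : ℝ → ℝ := fun t => M.ΨR Λ (Function.update q x t) s with hg
  have hexp : ∀ t, HasDerivAt (fun t => M.gaussExponent Λ s (Function.update q x t))
      (-(b + M.μ * t)) t := by
    intro t
    have h1 : (fun t => M.gaussExponent Λ s (Function.update q x t)) = fun t =>
        (-(1 / 2) * M.U0 Λ s - ∑ y ∈ Finset.univ.erase x,
          (M.μ * M.η * M.φ Λ y s * q y + M.μ / 2 * q y ^ 2)) - (b * t + M.μ / 2 * t ^ 2) := by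
      funext t
      rw [gaussExponent, ← Finset.add_sum_erase _ _ (Finset.mem_univ x), Function.update_self,
        Finset.sum_congr rfl fun y hy => by
          rw [Function.update_of_ne (Finset.ne_of_mem_erase hy)]]
      ring
    rw [h1]
    refine ((((hasDerivAt_id' t).const_mul b).add
      ((hasDerivAt_pow 2 t).const_mul (M.μ / 2))).const_sub _).congr_deriv ?_
    push_cast
    ring
  have hg1 : ∀ t, HasDerivAt g (-(b + M.μ * t) * g t) t := by
    intro t
    simp only [hg, ΨR_eq]
    refine (((hexp t).exp).const_mul (M.gaussNorm Λ)).congr_deriv ?_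
    ring
  have hg2 : ∀ t, HasDerivAt (fun t => -(b + M.μ * t) * g t)
      (((b + M.μ * t) ^ 2 - M.μ) * g t) t := by
    intro t
    refine (((((hasDerivAt_id' t).const_mul M.μ).const_add b).fun_neg).mul (hg1 t)).congr_deriv ?_
    ring
  have e0 : (fun t => M.Ψ Λ (Function.update q x t) s) = fun t => (g t : ℂ) := rfl
  have e1 : deriv (fun t => (g t : ℂ)) = fun t => ((-(b + M.μ * t) * g t : ℝ) : ℂ) :=
    funext fun t => (hg1 t).ofReal_comp.deriv
  rw [opD2, e0, iteratedDeriv_succ, iteratedDeriv_one, e1, (hg2 (q x)).ofReal_comp.deriv, Ψ_eq]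
  simp only [hg, Function.update_eq_self, hb]
  push_cast
  ring

lemma hamiltonian_Ψ : M.hamiltonian Λ (M.Ψ Λ) = 0 := by
  funext q s
  simp only [hamiltonian, opD2_Ψ, neg_add_cancel, Finset.sum_const_zero, zero_add, V_mul_Ψ, opS1Prod,
    add_neg_cancel]
  rfl

end SpinOscModel

/-! ### Positivity of the Hamiltonian -/

section Positivity

open MeasureTheory
open scoped LineDeriv

variable {d : ℕ} {Λ : Finset (Site d)}

/-- The complex conjugate of a Schwartz function. -/
def conjSchwartz (f : 𝓢(OscConfig Λ, ℂ)) : 𝓢(OscConfig Λ, ℂ) :=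
  SchwartzMap.postcompCLM (𝕜 := ℝ) (Complex.conjCLE : ℂ →L[ℝ] ℂ) f

lemma conjSchwartz_apply (f : 𝓢(OscConfig Λ, ℂ)) (q : OscConfig Λ) :
    conjSchwartz f q = (starRingEnd ℂ) (f q) := rfl

lemma lineDeriv_conjSchwartz (v : OscConfig Λ) (f : 𝓢(OscConfig Λ, ℂ)) (q : OscConfig Λ) :
    (∂_{v} (conjSchwartz f)) q = (starRingEnd ℂ) ((∂_{v} f) q) := by
  rw [SchwartzMap.lineDerivOp_apply_eq_fderiv, SchwartzMap.lineDerivOp_apply_eq_fderiv]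
  have h : HasFDerivAt (conjSchwartz f) ((Complex.conjCLE : ℂ →L[ℝ] ℂ).comp (fderiv ℝ f q)) q :=
    (Complex.conjCLE : ℂ →L[ℝ] ℂ).hasFDerivAt.comp q f.differentiableAt.hasFDerivAt
  rw [h.fderiv]
  rfl

/-- Multiplication of a Schwartz function by `q_x + b`. -/
def mulCoord (x : Λ) (b : ℝ) (f : 𝓢(OscConfig Λ, ℂ)) : 𝓢(OscConfig Λ, ℂ) :=
  SchwartzMap.smulLeftCLM ℂ (fun q : OscConfig Λ => q x + b) f

lemma mulCoord_apply (x : Λ) (b : ℝ) (f : 𝓢(OscConfig Λ, ℂ)) (q : OscConfig Λ) :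
    mulCoord x b f q = ((q x + b : ℝ) : ℂ) * f q := by
  have h : Function.HasTemperateGrowth fun q : OscConfig Λ => q x + b :=
    (hasTemperateGrowth_coord x).add (Function.HasTemperateGrowth.const b)
  rw [mulCoord, SchwartzMap.smulLeftCLM_apply_apply h, Complex.real_smul]

lemma lineDeriv_mulCoord (x : Λ) (b : ℝ) (f : 𝓢(OscConfig Λ, ℂ)) (q : OscConfig Λ) :
    (∂_{(Pi.single x 1 : OscConfig Λ)} (mulCoord x b f)) q =
      f q + ((q x + b : ℝ) : ℂ) * (∂_{(Pi.single x 1 : OscConfig Λ)} f) q := by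
  rw [SchwartzMap.lineDerivOp_apply_eq_fderiv, SchwartzMap.lineDerivOp_apply_eq_fderiv]
  have h1 : HasFDerivAt (fun q : OscConfig Λ => q x + b)
      (ContinuousLinearMap.proj (R := ℝ) (φ := fun _ : Λ => ℝ) x) q :=
    (ContinuousLinearMap.proj (R := ℝ) (φ := fun _ : Λ => ℝ) x).hasFDerivAt.add_const b
  have h2 := h1.smul (f.differentiableAt (x := q)).hasFDerivAt
  have h3 : (mulCoord x b f : OscConfig Λ → ℂ) = fun q => (q x + b) • f q := by
    funext q
    rw [mulCoord_apply, Complex.real_smul]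
  have h4 : (fun q : OscConfig Λ => q x + b) • (f : OscConfig Λ → ℂ) =
    fun q => (q x + b) • f q := rfl
  rw [h3, ← h4, h2.fderiv]
  simp [Complex.real_smul]
  ring

/-- Along a coordinate axis the second line derivative is the second partial derivative. -/
lemma opD2_eq_lineDeriv {F : WaveFn Λ} {s : SpinConfig Λ} {f : 𝓢(OscConfig Λ, ℂ)}
    (hF : ∀ q, F q s = f q) (x : Λ) (q : OscConfig Λ) :
    opD2 x F q s =
      (∂_{(Pi.single x 1 : OscConfig Λ)} (∂_{(Pi.single x 1 : OscConfig Λ)} f)) q := by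
  have hd : ∀ (g : 𝓢(OscConfig Λ, ℂ)) (t : ℝ),
      deriv (fun t : ℝ => g (Function.update q x t)) t =
        (∂_{(Pi.single x 1 : OscConfig Λ)} g) (Function.update q x t) := by
    intro g t
    have h1 := (g.differentiableAt (x := Function.update q x t)).hasFDerivAt.comp_hasDerivAt t
      (hasDerivAt_update q x t)
    rw [SchwartzMap.lineDerivOp_apply_eq_fderiv]
    exact h1.deriv
  simp only [opD2, hF]
  rw [iteratedDeriv_succ, iteratedDeriv_one]
  have h1 : deriv (fun t : ℝ => f (Function.update q x t)) = fun t =>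
      (∂_{(Pi.single x 1 : OscConfig Λ)} f) (Function.update q x t) := funext (hd f)
  rw [h1, hd, Function.update_eq_self]

lemma integrable_mul_schwartz (f g : 𝓢(OscConfig Λ, ℂ)) : Integrable fun q => f q * g q :=
  (f.memLp 2 volume).integrable_mul (g.memLp 2 volume)

/-- One oscillator: with `a = ∂_x + μ (q_x + b)` the operator is `a† a`,
where `a† = -∂_x + μ (q_x + b)`. -/
lemma oscillator_nonneg (x : Λ) (b m : ℝ) (f : 𝓢(OscConfig Λ, ℂ)) :
    (Integrable fun q => (starRingEnd ℂ) (f q) *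
      (-(∂_{(Pi.single x 1 : OscConfig Λ)} (∂_{(Pi.single x 1 : OscConfig Λ)} f)) q +
        ((m ^ 2 * (q x + b) ^ 2 - m : ℝ) : ℂ) * f q)) ∧
    0 ≤ (∫ q, (starRingEnd ℂ) (f q) *
      (-(∂_{(Pi.single x 1 : OscConfig Λ)} (∂_{(Pi.single x 1 : OscConfig Λ)} f)) q +
        ((m ^ 2 * (q x + b) ^ 2 - m : ℝ) : ℂ) * f q)).re := by
  set e : OscConfig Λ := Pi.single x 1 with he
  set g : 𝓢(OscConfig Λ, ℂ) := ∂_{e} f + m • mulCoord x b f with hg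
  have hgq : ∀ q, g q = (∂_{e} f) q + (m : ℂ) * (((q x + b : ℝ) : ℂ) * f q) := by
    intro q
    simp only [hg, add_apply, smul_apply, mulCoord_apply,
      Complex.real_smul]
  have hdg : ∀ q, (∂_{e} g) q = (∂_{e} (∂_{e} f)) q +
      (m : ℂ) * (f q + ((q x + b : ℝ) : ℂ) * (∂_{e} f) q) := by
    intro q
    rw [hg, LineDeriv.lineDerivOp_add, LineDeriv.lineDerivOp_smul]
    simp only [add_apply, smul_apply, Complex.real_smul]
    rw [he, lineDeriv_mulCoord]
  have h1 : ∀ q, (starRingEnd ℂ) (f q) *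
      (-(∂_{e} (∂_{e} f)) q + ((m ^ 2 * (q x + b) ^ 2 - m : ℝ) : ℂ) * f q) =
      -(conjSchwartz f q * (∂_{e} g) q) + conjSchwartz f q * (m • mulCoord x b g) q := by
    intro q
    rw [smul_apply, mulCoord_apply, hdg, hgq, conjSchwartz_apply, Complex.real_smul]
    push_cast
    ring
  have i1 := integrable_mul_schwartz (conjSchwartz f) (∂_{e} g)
  have i2 := integrable_mul_schwartz (conjSchwartz f) (m • mulCoord x b g)
  have i3 := integrable_mul_schwartz (∂_{e} (conjSchwartz f)) g
  simp only [h1]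
  have i4 : Integrable fun q => -(conjSchwartz f q * (∂_{e} g) q) := i1.neg
  refine ⟨i4.add i2, ?_⟩
  have h2 : (∫ q, -(conjSchwartz f q * (∂_{e} g) q) + conjSchwartz f q * (m • mulCoord x b g) q) =
      ∫ q, ((Complex.normSq (g q) : ℝ) : ℂ) := by
    rw [integral_add i4 i2, integral_neg,
      SchwartzMap.integral_mul_lineDerivOp_right_eq_neg_left, neg_neg, ← integral_add i3 i2]
    refine integral_congr_ae (Filter.Eventually.of_forall fun q => ?_)
    simp only
    rw [lineDeriv_conjSchwartz, smul_apply, mulCoord_apply, conjSchwartz_apply,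
      Complex.normSq_eq_conj_mul_self, Complex.real_smul]
    conv_rhs => rw [hgq q]
    simp only [hgq, map_add, map_mul, Complex.conj_ofReal]
    ring
  rw [h2, integral_complex_ofReal, Complex.ofReal_re]
  exact integral_nonneg fun q => Complex.normSq_nonneg _

/-- Spin flips: with `u = exp (-w / 2)`, the terms at `s` and at `s^A`, where `u` and `F` take the
values `u'` and `F'`, add up to `(u'/u) |F|² + (u/u') |F'|² - 2 Re (conj F F') ≥ 0`. -/
lemma flip_form_nonneg (A : Finset Λ) (w : SpinConfig Λ → ℝ) (F : SpinConfig Λ → ℂ) :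
    0 ≤ ∑ s, (Real.exp (-(1 / 2) * (w (flipSpins A s) - w s)) * ‖F s‖ ^ 2 -
      ((starRingEnd ℂ) (F s) * F (flipSpins A s)).re) := by
  set G : SpinConfig Λ → ℝ := fun s =>
    Real.exp (-(1 / 2) * (w (flipSpins A s) - w s)) * ‖F s‖ ^ 2 -
      ((starRingEnd ℂ) (F s) * F (flipSpins A s)).re with hG
  have h1 : ∑ s, G (flipSpins A s) = ∑ s, G s :=
    Equiv.sum_comp (Function.Involutive.toPerm (flipSpins A) (flipSpins_flipSpins A)) G
  have h2 : ∀ s, 0 ≤ G s + G (flipSpins A s) := by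
    intro s
    simp only [hG, flipSpins_flipSpins]
    have h3 : ∀ z z' : ℂ, ((starRingEnd ℂ) z * z').re ≤ ‖z‖ * ‖z'‖ := fun z z' =>
      (Complex.re_le_norm _).trans (by rw [norm_mul, Complex.norm_conj])
    have h4 := h3 (F s) (F (flipSpins A s))
    have h5 := h3 (F (flipSpins A s)) (F s)
    set ρ := Real.exp (-(1 / 4) * (w (flipSpins A s) - w s)) with hρ
    set σ := Real.exp (-(1 / 4) * (w s - w (flipSpins A s))) with hσ
    have e1 : Real.exp (-(1 / 2) * (w (flipSpins A s) - w s)) = ρ * ρ := by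
      rw [hρ, ← Real.exp_add]; congr 1; ring
    have e2 : Real.exp (-(1 / 2) * (w s - w (flipSpins A s))) = σ * σ := by
      rw [hσ, ← Real.exp_add]; congr 1; ring
    have e3 : ρ * σ = 1 := by
      rw [hρ, hσ, ← Real.exp_add, ← Real.exp_zero]; congr 1; ring
    rw [e1, e2]
    have e4 := sq_nonneg (ρ * ‖F s‖ - σ * ‖F (flipSpins A s)‖)
    have e5 : (ρ * ‖F s‖ - σ * ‖F (flipSpins A s)‖) ^ 2 = ρ * ρ * ‖F s‖ ^ 2 +
        σ * σ * ‖F (flipSpins A s)‖ ^ 2 - 2 * (ρ * σ) * (‖F s‖ * ‖F (flipSpins A s)‖) := by ring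
    rw [e5, e3] at e4
    linarith
  have h6 := Finset.sum_nonneg fun s (_ : s ∈ Finset.univ) => h2 s
  rw [Finset.sum_add_distrib, h1] at h6
  change 0 ≤ ∑ s, G s
  linarith

end Positivity

namespace SpinOscModel

open MeasureTheory

variable {d : ℕ} (M : SpinOscModel d) (Λ : Finset (Site d))

/-- The part of the Hamiltonian that does not differentiate, without the oscillator potential. -/
def flipPart (F : WaveFn Λ) : WaveFn Λ := fun q s =>
  ∑ A : Finset Λ, (M.JS Λ A q : ℂ) * opS1Prod A F q s + (M.V Λ q s : ℂ) * F q s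

lemma re_sum_flipPart_nonneg (F : WaveFn Λ) (q : OscConfig Λ) :
    0 ≤ (∑ s, (starRingEnd ℂ) (F q s) * M.flipPart Λ F q s).re := by
  have h1 : (∑ s, (starRingEnd ℂ) (F q s) * M.flipPart Λ F q s).re =
      ∑ A : Finset Λ, -M.JS Λ A q *
        ∑ s, (Real.exp (-(1 / 2) * (M.U Λ (flipSpins A s) q - M.U Λ s q)) * ‖F q s‖ ^ 2 -
          ((starRingEnd ℂ) (F q s) * F q (flipSpins A s)).re) := by
    simp only [Finset.mul_sum]
    rw [Finset.sum_comm, Complex.re_sum]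
    refine Finset.sum_congr rfl fun s _ => ?_
    have h2 : (starRingEnd ℂ) (F q s) * M.flipPart Λ F q s =
        ∑ A : Finset Λ, (M.JS Λ A q : ℂ) * ((starRingEnd ℂ) (F q s) * F q (flipSpins A s)) +
          ((M.V Λ q s * ‖F q s‖ ^ 2 : ℝ) : ℂ) := by
      rw [flipPart, mul_add, Finset.mul_sum]
      congr 1
      · exact Finset.sum_congr rfl fun A _ => mul_left_comm _ _ _
      · rw [mul_left_comm, ← Complex.normSq_eq_conj_mul_self, Complex.normSq_eq_norm_sq]
        push_cast
        ring
    rw [h2, Complex.add_re, Complex.re_sum, Complex.ofReal_re, V, neg_mul, Finset.sum_mul,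
      ← sub_eq_add_neg, ← Finset.sum_sub_distrib]
    refine Finset.sum_congr rfl fun A _ => ?_
    rw [Complex.re_ofReal_mul]
    ring
  rw [h1]
  exact Finset.sum_nonneg fun A _ => mul_nonneg (neg_nonneg.2 (M.JS_nonpos Λ A q))
    (flip_form_nonneg A (fun s => M.U Λ s q) (F q))

lemma integrable_flipPart {F : WaveFn Λ} (hF : F ∈ M.domain Λ) (s : SpinConfig Λ) :
    Integrable fun q => (starRingEnd ℂ) (F q s) * M.flipPart Λ F q s := by
  obtain ⟨⟨f, hf⟩, hV⟩ := hF s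
  have h1 : (fun q => (starRingEnd ℂ) (F q s) * M.flipPart Λ F q s) = fun q =>
      ∑ A : Finset Λ, (M.JS Λ A q : ℂ) * ((starRingEnd ℂ) (F q s) * F q (flipSpins A s)) +
        conjSchwartz f q * ((M.V Λ q s : ℂ) * F q s) := by
    funext q
    rw [flipPart, mul_add, Finset.mul_sum, conjSchwartz_apply, hf q]
    congr 1
    exact Finset.sum_congr rfl fun A _ => mul_left_comm _ _ _
  rw [h1]
  refine (integrable_finsetSum _ fun A _ => ?_).add
    (((conjSchwartz f).memLp 2 volume).integrable_mul hV)
  obtain ⟨⟨g, hg⟩, -⟩ := hF (flipSpins A s)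
  obtain ⟨K, hK⟩ := M.JS_bounded Λ A
  have h2 : Integrable fun q => (starRingEnd ℂ) (F q s) * F q (flipSpins A s) := by
    simp only [hf, hg]
    exact integrable_mul_schwartz (conjSchwartz f) g
  refine h2.bdd_mul (c := K)
    (Complex.measurable_ofReal.comp (M.JS_measurable Λ A)).aestronglyMeasurable
    (Filter.Eventually.of_forall fun q => ?_)
  rw [Complex.norm_real, Real.norm_eq_abs]
  exact hK q

theorem re_waveInner_hamiltonian_nonneg {F : WaveFn Λ} (hF : F ∈ M.domain Λ) :
    0 ≤ (waveInner F (M.hamiltonian Λ F)).re := by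
  set osc : Λ → SpinConfig Λ → OscConfig Λ → ℂ := fun x s q => (starRingEnd ℂ) (F q s) *
    (-opD2 x F q s + ((M.μ ^ 2 * (q x + M.η * M.φ Λ x s) ^ 2 - M.μ : ℝ) : ℂ) * F q s) with hosc
  have hoscp : ∀ x s, Integrable (osc x s) ∧ 0 ≤ (∫ q, osc x s q).re := by
    intro x s
    obtain ⟨⟨f, hf⟩, -⟩ := hF s
    have h := oscillator_nonneg x (M.η * M.φ Λ x s) M.μ f
    simp only [hosc, opD2_eq_lineDeriv hf, hf]
    exact h
  have hfl := M.integrable_flipPart Λ hF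
  have h1 : waveInner F (M.hamiltonian Λ F) = (∑ s, ∑ x, ∫ q, osc x s q) +
      ∫ q, ∑ s, (starRingEnd ℂ) (F q s) * M.flipPart Λ F q s := by
    rw [integral_finsetSum _ fun s _ => hfl s, ← Finset.sum_add_distrib, waveInner]
    refine Finset.sum_congr rfl fun s _ => ?_
    rw [← integral_finsetSum _ fun x _ => (hoscp x s).1,
      ← integral_add (integrable_finsetSum _ fun x _ => (hoscp x s).1) (hfl s)]
    refine integral_congr_ae (Filter.Eventually.of_forall fun q => ?_)
    simp only [hosc, hamiltonian, flipPart, ← Finset.mul_sum]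
    ring
  rw [h1, Complex.add_re, Complex.re_sum]
  refine add_nonneg (Finset.sum_nonneg fun s _ => ?_) ?_
  · rw [Complex.re_sum]
    exact Finset.sum_nonneg fun x _ => (hoscp x s).2
  · have h2 := integral_re (𝕜 := ℂ) (integrable_finsetSum Finset.univ fun s _ => hfl s)
    simp only [RCLike.re_to_complex] at h2
    rw [← h2]
    exact integral_nonneg fun q => M.re_sum_flipPart_nonneg Λ F q

theorem isGroundState_Ψ : IsGroundState (M.hamiltonian Λ) (M.domain Λ) (M.Ψ Λ) := by
  refine ⟨M.Ψ_mem_domain Λ, M.Ψ_ne_zero Λ, 0, fun q s => ?_, fun F hF => ?_⟩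
  · rw [M.hamiltonian_Ψ Λ]
    simp
  · rw [zero_mul]
    exact M.re_waveInner_hamiltonian_nonneg Λ hF

end SpinOscModel

end

theorem theorem2 (d : ℕ) :
    -- the Gibbsian vector is the zero-energy ground state of the Hamiltonian
    (∀ M : SpinOscModel d, ∀ Λ : Finset (Site d), IsHypercube Λ →
        IsGroundState (M.hamiltonian Λ) (M.domain Λ) (M.Ψ Λ) ∧
        M.hamiltonian Λ (M.Ψ Λ) = 0) ∧
    -- long-range order in `S³` and in the oscillator variables
    (2 ≤ d → ∃ β₀ : ℝ, 1 < β₀ ∧ ∃ a : ℝ, 0 < a ∧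
      ∀ M : SpinOscModel d, (∀ x A, 0 ≤ M.J₀ x A) → (∀ x A, Even A.card → M.J₀ x A = 0) →
      ∀ Jbar : ℝ, (∀ x y : Site d, NearestNeighbors x y →
          Jbar ≤ M.J₀ x {y} ∧ Jbar ≤ M.JU {x, y}) →
        β₀ ≤ (M.η ^ 2 * M.μ + M.α) * Jbar →
      ∀ Λ : Finset (Site d), IsHypercube Λ → ∀ x y : Λ,
        a ≤ (M.average Λ (fun F => opS3 x (opS3 y F))).re ∧
        M.η ^ 2 * a ≤ (M.average Λ (fun F => opQ x (opQ y F))).re) ∧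
    -- long-range order in `S¹`
    (∀ M : SpinOscModel d, (∀ x A, 0 ≤ M.J₀ x A) → (∀ x A, Even A.card → M.J₀ x A = 0) →
      ∀ C B₁ B₂ : ℝ, 0 < C → 0 < B₁ → 0 < B₂ →
        (∀ Λ : Finset (Site d), IsHypercube Λ → ∀ (x : Λ) (s : SpinConfig Λ),
          |M.φ Λ x s| ≤ C) →
        (∀ Λ : Finset (Site d), IsHypercube Λ → ∀ A : Finset Λ, A.card = 2 →
          ∀ s : SpinConfig Λ, M.W Λ 1 A s ≤ B₁ ∧ M.W Λ 2 A s ≤ B₂) →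
      ∀ Λ : Finset (Site d), IsHypercube Λ → ∀ x y : Λ,
        Real.exp (-(M.η ^ 2 * M.μ / 4) * (B₂ + 2 * C * B₁) - M.α / 2 * (4 * M.normJU))
          ≤ (M.average Λ (fun F => opS1 x (opS1 y F))).re) := by
  refine ⟨fun M Λ _ => ⟨M.isGroundState_Ψ Λ, M.hamiltonian_Ψ Λ⟩, fun hd => ?_, ?_⟩
  · have hd0 : (0 : ℝ) ≤ d := Nat.cast_nonneg d
    -- for `β` at least this, `d` moves cost at most `d * 3072 * exp (-2 β) ≤ 1 / 2`
    refine ⟨6144 * ((d : ℝ) + 1), by linarith, 1 / 2, by norm_num, ?_⟩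
    intro M hJ₀ _ Jbar hJ hβ Λ hΛ x y
    have h := M.half_le_average_opS3_opS3 hd hΛ hJ₀ hJ hβ x y
    exact ⟨h, (mul_le_mul_of_nonneg_left h (sq_nonneg M.η)).trans (M.le_average_opQ_opQ hJ₀ x y)⟩
  · intro M _ _ C B₁ B₂ hC hB₁ hB₂ hφ hW Λ hΛ x y
    exact M.le_average_opS1_opS1 Λ hC.le hB₁.le hB₂.le (hφ Λ hΛ) (hW Λ hΛ) x y
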